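/- Let $\mathbb{H}$ be a separable real or complex Hilbert space, let $\vartheta=\{\vartheta^t\}_{t\ge 0}$ be a (continuous) semiflow on a complete metric space $\mathcal{Q}$, and let $\Xi$ be a uniformly continuous linear cocycle in $\mathbb{H}$ over $(\mathcal{Q},\vartheta)$: bounded linear operators $\Xi^t(q)$, $t\ge 0$, $q\in\mathcal{Q}$, with $\Xi^0(q)=\mathrm{Id}$, $\Xi^{t+s}(q)=\Xi^t(\vartheta^s(q))\,\Xi^s(q)$, such that $(t,q,\xi)\mapsto\Xi^t(q)\xi$ is continuous, $q\mapsto\Xi^t(q)$ is continuous in the operator norm for each $t$, and $\sup_{t\in[0,1],\,q}\|\Xi^t(q)\|<\infty$. Let $\mathfrak{n}=\{\mathfrak{n}_q\}_{q\in\mathcal{Q}}$ be a family of norms on $\mathbb{H}$ induced by inner products $\langle\cdot,\cdot\rangle_q$ and uniformly equivalent to the norm of $\mathbb{H}$, i.e. $a\|\xi\|\le\mathfrak{n}_q(\xi)\le b\|\xi\|$ for all $q,\xi$ with constants $a,b>0$. Suppose that $\Xi$ admits infinitesimal growth exponents with respect to $\mathfrak{n}$ with domains $\mathcal{N}(q)$: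 each $\mathcal{N}(q)$ is a dense subspace of $\mathbb{H}$, $\Xi^t(q)\mathcal{N}(q)\subset\mathcal{N}(\vartheta^t(q))$ for $t\ge0$, and for every $\xi\in\mathcal{N}(q)$ the function $t\mapsto\mathfrak{n}_{\vartheta^t(q)}(\Xi^t(q)\xi)$ is absolutely continuous on each $[0,T]$ and has a right derivative at $t=0$. The curvature form is $$B_{\mathfrak{n}}(q;\xi,\eta)=\frac12\lim_{t\to0+}\frac{\langle\Xi^t(q)\xi,\Xi^t(q)\eta\rangle_{\vartheta^t(q)}-\langle\xi,\eta\rangle_q}{t},\qquad \xi,\eta\in\mathcal{N}(q).$$ Let $A_{\mathfrak{n}}$ be a mean representation of $B_{\mathfrak{n}}$, i.e. a family of (possibly unbounded) linear operators $A_{\mathfrak{n}}(q)$ in $\mathbb{H}$ with $\mathcal{D}(A_{\mathfrak{n}}(q))\supset\mathcal{N}(q)$ and $B_{\mathfrak{n}}(q;\xi,\xi)=\operatorname{Re}\langle\xi,A_{\mathfrak{n}}(q)\xi\rangle_q$ for all $\xi\in\mathcal{N}(q)$. The trace numbers $\beta_k(A_{\mathfrak{n}}(q))\in[-\infty,+\infty]$,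 $k=1,2,\dots$, are determined inductively by $$\beta_1+\dots+\beta_k=\sup_{\mathbb{L}\subset\mathcal{D}(A_{\mathfrak{n}}(q)),\ \dim\mathbb{L}=k}\operatorname{Re}\operatorname{Tr}\left(\Pi_{\mathbb{L}}\circ A_{\mathfrak{n}}(q)\circ\Pi_{\mathbb{L}}\right),$$ where $\Pi_{\mathbb{L}}$ is the projector onto $\mathbb{L}$ orthogonal with respect to $\langle\cdot,\cdot\rangle_q$; the supremum over the empty set is $-\infty$, $\beta_k=+\infty$ if the supremum is $+\infty$, and $0\cdot(\pm\infty)=0$. For $T\in\mathcal{L}(\mathbb{H})$ let $\sigma_k(T)=\sup_{\dim\mathbb{L}=k}\inf_{\xi\in\mathbb{L},\|\xi\|=1}\|T\xi\|$ (equal to $0$ if $\dim\mathbb{H}<k$) be its singular values and, for $d=m+\gamma$ with an integer $m\ge0$ and $\gamma\in[0,1]$, let $\omega_d(T)=\sigma_1(T)\cdots\sigma_m(T)\,\sigma_{m+1}(T)^{\gamma}$. Then the limit $$\overline{\omega}_d(\Xi)=\lim_{t\to+\infty}\Big(\sup_{q\in\mathcal{Q}}\omega_d(\Xi^t(q))\Big)^{1/t}$$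 exists, and (with $\ln 0=-\infty$) $$\ln\overline{\omega}_d(\Xi)\le\sup_{q\in\mathcal{Q}}\Big[\sum_{j=1}^m\beta_j(A_{\mathfrak{n}}(q))+\gamma\,\beta_{m+1}(A_{\mathfrak{n}}(q))\Big].$$ Moreover, if for all $q\in\mathcal{Q}$ and $j\in\{1,\dots,m+1\}$ the function $s\mapsto\beta_j(A_{\mathfrak{n}}(\vartheta^s(q)))$ is integrable on finite time intervals, put $$F(t)=\sup_{q\in\mathcal{Q}}\int_0^t\Big[\sum_{j=1}^m\beta_j(A_{\mathfrak{n}}(\vartheta^s(q)))+\gamma\,\beta_{m+1}(A_{\mathfrak{n}}(\vartheta^s(q)))\Big]ds\in[-\infty,+\infty].$$ Then $$\ln\overline{\omega}_d(\Xi)\le\liminf_{t\to+\infty}\frac{F(t)}{t},$$ and if $F(t)<+\infty$ for all sufficiently large $t$, then $\lim_{t\to+\infty}F(t)/t$ exists in $[-\infty,+\infty]$, so that $$\ln\overline{\omega}_d(\Xi)\le\lim_{t\to+\infty}\frac1t\sup_{q\in\mathcal{Q}}\int_0^t\Big[\sum_{j=1}^m\beta_j(A_{\mathfrak{n}}(\vartheta^s(q)))+\gamma\,\beta_{m+1}(A_{\mathfrak{n}}(\vartheta^s(q)))\Big]ds.$$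 -/

import Mathlib

open Filter Topology MeasureTheory
open scoped NNReal ENNReal

noncomputable section

/-! ### Linear cocycles over a semiflow -/

/-- `Ξ` is a uniformly continuous linear cocycle in `H` over the semiflow `ϑ` on `Q`. -/
structure IsUniformlyContinuousCocycle {𝕜 H Q : Type*} [RCLike 𝕜] [NormedAddCommGroup H]
    [InnerProductSpace 𝕜 H] [TopologicalSpace Q] (ϑ : Flow ℝ≥0 Q)
    (Ξ : ℝ≥0 → Q → H →L[𝕜] H) : Prop where
  map_zero : ∀ q, Ξ 0 q = ContinuousLinearMap.id 𝕜 H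
  map_add : ∀ t s q, Ξ (t + s) q = (Ξ t (ϑ s q)).comp (Ξ s q)
  continuous_apply : Continuous fun p : ℝ≥0 × Q × H => Ξ p.1 p.2.1 p.2.2
  continuous_norm : ∀ t, Continuous fun q => Ξ t q
  bounded : ∃ C : ℝ, ∀ t : ℝ≥0, t ≤ 1 → ∀ q, ‖Ξ t q‖ ≤ C

/-! ### Singular values and the averaged function of singular values -/

/-- The `k`-th singular value (`k = 1, 2, …`) of a bounded operator: the supremum over all
`k`-dimensional subspaces of the infimum of `‖T ξ‖` over the unit vectors `ξ` of the subspace. -/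
def singularValue {𝕜 H : Type*} [RCLike 𝕜] [NormedAddCommGroup H] [InnerProductSpace 𝕜 H]
    (T : H →L[𝕜] H) (k : ℕ) : ℝ≥0∞ :=
  ⨆ (L : Submodule 𝕜 H) (_ : FiniteDimensional 𝕜 L) (_ : Module.finrank 𝕜 L = k),
    ⨅ (ξ : H) (_ : ξ ∈ L) (_ : ‖ξ‖ = 1), ‖T ξ‖ₑ

/-- The function of singular values `ω_d(T)` for `d = m + γ`. -/
def omegaD {𝕜 H : Type*} [RCLike 𝕜] [NormedAddCommGroup H] [InnerProductSpace 𝕜 H]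
    (m : ℕ) (γ : ℝ) (T : H →L[𝕜] H) : ℝ≥0∞ :=
  (∏ j ∈ Finset.Icc 1 m, singularValue T j) * singularValue T (m + 1) ^ γ

/-- The function of time `(sup_q ω_d(Ξ^t(q)))^{1/t}` whose limit is `ω̄_d(Ξ)`. -/
def omegaRoot {𝕜 H Q : Type*} [RCLike 𝕜] [NormedAddCommGroup H] [InnerProductSpace 𝕜 H]
    (Ξ : ℝ≥0 → Q → H →L[𝕜] H) (m : ℕ) (γ : ℝ) (t : ℝ≥0) : ℝ≥0∞ :=
  (⨆ q, omegaD m γ (Ξ t q)) ^ (1 / (t : ℝ))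

/-- The averaged function of singular values `ω̄_d(Ξ)`, `d = m + γ`, as a limit in `[0, ∞]`. -/
def averagedOmega {𝕜 H Q : Type*} [RCLike 𝕜] [NormedAddCommGroup H] [InnerProductSpace 𝕜 H]
    (Ξ : ℝ≥0 → Q → H →L[𝕜] H) (m : ℕ) (γ : ℝ) : ℝ≥0∞ :=
  limUnder atTop (omegaRoot Ξ m γ)

/-! ### Metrics over the base: families of inner products -/

/-- The norm induced by an inner product `c` on a vector space. -/
def coreNorm {𝕜 V : Type*} [RCLike 𝕜] [AddCommGroup V] [Module 𝕜 V]
    (c : InnerProductSpace.Core 𝕜 V) (ξ : V) : ℝ :=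
  √(RCLike.re (c.inner ξ ξ))

/-- The family `n` of inner products is uniformly equivalent to the inner product of `H`. -/
def UniformlyEquivalent {𝕜 H Q : Type*} [RCLike 𝕜] [NormedAddCommGroup H]
    [InnerProductSpace 𝕜 H] (n : Q → InnerProductSpace.Core 𝕜 H) : Prop :=
  ∃ a b : ℝ, 0 < a ∧ 0 < b ∧ ∀ q ξ, a * ‖ξ‖ ≤ coreNorm (n q) ξ ∧ coreNorm (n q) ξ ≤ b * ‖ξ‖

/-- `Ξ` admits infinitesimal growth exponents with respect to the family of norms `ν`, with the
domains `N q`. -/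
structure AdmitsGrowthExponents {𝕜 H Q : Type*} [RCLike 𝕜] [NormedAddCommGroup H]
    [InnerProductSpace 𝕜 H] [TopologicalSpace Q] (ϑ : Flow ℝ≥0 Q)
    (Ξ : ℝ≥0 → Q → H →L[𝕜] H) (ν : Q → H → ℝ) (N : Q → Submodule 𝕜 H) : Prop where
  dense : ∀ q, Dense (N q : Set H)
  invariant : ∀ t q, ∀ ξ ∈ N q, Ξ t q ξ ∈ N (ϑ t q)
  absolutelyContinuous : ∀ q, ∀ ξ ∈ N q, ∀ T : ℝ, 0 < T →
    AbsolutelyContinuousOnInterval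
      (fun t : ℝ => ν (ϑ t.toNNReal q) (Ξ t.toNNReal q ξ)) 0 T
  rightDerivative : ∀ q, ∀ ξ ∈ N q, ∃ D : ℝ,
    Tendsto (fun t : ℝ≥0 => (ν (ϑ t q) (Ξ t q ξ) - ν q ξ) / (t : ℝ)) (𝓝[>] 0) (𝓝 D)

/-! ### The curvature form and its mean representations -/

/-- The curvature form of `Ξ` in the metric `n` over `q` has the value `b` at `(ξ, η)`. -/
def HasCurvatureForm {𝕜 H Q : Type*} [RCLike 𝕜] [NormedAddCommGroup H]
    [InnerProductSpace 𝕜 H] [TopologicalSpace Q] (ϑ : Flow ℝ≥0 Q)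
    (Ξ : ℝ≥0 → Q → H →L[𝕜] H) (n : Q → InnerProductSpace.Core 𝕜 H) (q : Q) (ξ η : H)
    (b : 𝕜) : Prop :=
  Tendsto (fun t : ℝ≥0 =>
      (1 / 2 : 𝕜) *
        (((n (ϑ t q)).inner (Ξ t q ξ) (Ξ t q η) - (n q).inner ξ η) / ((t : ℝ) : 𝕜)))
    (𝓝[>] 0) (𝓝 b)

/-- The family of (possibly unbounded) operators `A` is a mean representation of the curvature
form of `Ξ` in the metric `n` with domains `N q`. -/
def IsMeanRepresentation {𝕜 H Q : Type*} [RCLike 𝕜] [NormedAddCommGroup H]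
    [InnerProductSpace 𝕜 H] [TopologicalSpace Q] (ϑ : Flow ℝ≥0 Q)
    (Ξ : ℝ≥0 → Q → H →L[𝕜] H) (n : Q → InnerProductSpace.Core 𝕜 H)
    (N : Q → Submodule 𝕜 H) (A : Q → H →ₗ.[𝕜] H) : Prop :=
  ∀ q, N q ≤ (A q).domain ∧
    ∀ ξ : (A q).domain, (ξ : H) ∈ N q →
      HasCurvatureForm ϑ Ξ n q ξ ξ ((RCLike.re ((n q).inner (ξ : H) (A q ξ)) : ℝ) : 𝕜)

/-! ### Trace numbers -/

/-- The projector onto a finite-dimensional subspace `L`, orthogonal with respect to `c`. -/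
def coreProjection {𝕜 V : Type*} [RCLike 𝕜] [AddCommGroup V] [Module 𝕜 V]
    (c : InnerProductSpace.Core 𝕜 V) (L : Submodule 𝕜 V) [FiniteDimensional 𝕜 L] : V →ₗ[𝕜] L :=
  letI : NormedAddCommGroup V := c.toNormedAddCommGroup
  letI : InnerProductSpace 𝕜 V := InnerProductSpace.ofCore c.toCore
  (L.orthogonalProjectionOnto : V →L[𝕜] L).toLinearMap

/-- `Re Tr (Π_L ∘ A ∘ Π_L)` for a finite-dimensional subspace `L` of the domain of `A`, where
`Π_L` is the `c`-orthogonal projector onto `L`. The operator has its range in `L` and vanishes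
on the complement of `L`, so its trace is the trace of its restriction to `L`. -/
def reTrace {𝕜 V : Type*} [RCLike 𝕜] [AddCommGroup V] [Module 𝕜 V]
    (c : InnerProductSpace.Core 𝕜 V) (A : V →ₗ.[𝕜] V) (L : Submodule 𝕜 V)
    [FiniteDimensional 𝕜 L] (hL : L ≤ A.domain) : ℝ :=
  RCLike.re (LinearMap.trace 𝕜 L (coreProjection c L ∘ₗ A.toFun ∘ₗ Submodule.inclusion hL))

/-- The supremum of `Re Tr (Π_L ∘ A ∘ Π_L)` over the `k`-dimensional subspaces `L` of the domain
of `A`, in `[-∞, ∞]` (it is `-∞` if there are no such subspaces). -/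
def traceSum {𝕜 V : Type*} [RCLike 𝕜] [AddCommGroup V] [Module 𝕜 V]
    (c : InnerProductSpace.Core 𝕜 V) (A : V →ₗ.[𝕜] V) (k : ℕ) : EReal :=
  ⨆ (L : Submodule 𝕜 V) (_ : FiniteDimensional 𝕜 L) (hL : L ≤ A.domain)
    (_ : Module.finrank 𝕜 L = k), ((reTrace c A L hL : ℝ) : EReal)

open Classical in
/-- The trace numbers `β_k(A)`, `k = 1, 2, …`, with respect to the inner product `c`, determined
by `β_1 + … + β_k = traceSum k`. If `traceSum k = ∞`, then `β_k = ∞`, so that no difference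
`∞ - ∞` occurs. The value at `0` is not used. -/
def traceNumber {𝕜 V : Type*} [RCLike 𝕜] [AddCommGroup V] [Module 𝕜 V]
    (c : InnerProductSpace.Core 𝕜 V) (A : V →ₗ.[𝕜] V) : ℕ → EReal
  | 0 => 0
  | k + 1 => if traceSum c A (k + 1) = ⊤ then ⊤ else traceSum c A (k + 1) - traceSum c A k

/-- `β_1(A) + … + β_m(A) + γ β_{m+1}(A)`. -/
def fractionalTraceSum {𝕜 V : Type*} [RCLike 𝕜] [AddCommGroup V] [Module 𝕜 V]
    (c : InnerProductSpace.Core 𝕜 V) (A : V →ₗ.[𝕜] V) (m : ℕ) (γ : ℝ) : EReal :=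
  (∑ j ∈ Finset.Icc 1 m, traceNumber c A j) + (γ : EReal) * traceNumber c A (m + 1)

/-- An extended-real function on `[0, ∞)` is integrable on finite time intervals: it is finite
almost everywhere and its real part is integrable on each `[0, T]`. -/
def LocallyIntegrableInTime (f : ℝ≥0 → EReal) : Prop :=
  (∀ᵐ s : ℝ, 0 < s → f s.toNNReal ≠ ⊤ ∧ f s.toNNReal ≠ ⊥) ∧
    ∀ T : ℝ, 0 < T → IntervalIntegrable (fun s : ℝ => (f s.toNNReal).toReal) volume 0 T

/-- `sup_q ∫_0^t [β_1 + … + β_m + γ β_{m+1}](A(ϑ^s(q))) ds`, in `[-∞, ∞]`. -/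
def maximalTraceIntegral {𝕜 H Q : Type*} [RCLike 𝕜] [AddCommGroup H] [Module 𝕜 H]
    [TopologicalSpace Q] (ϑ : Flow ℝ≥0 Q) (n : Q → InnerProductSpace.Core 𝕜 H)
    (A : Q → H →ₗ.[𝕜] H) (m : ℕ) (γ : ℝ) (t : ℝ≥0) : EReal :=
  ⨆ q, ((∫ s in (0 : ℝ)..t,
    (fractionalTraceSum (n (ϑ s.toNNReal q)) (A (ϑ s.toNNReal q)) m γ).toReal : ℝ) : EReal)

end

/-! Volumes, expressed through Gram determinants, replace exterior powers throughout. The largest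
volume `maxVolume k T` of the image of an orthonormal `k`-family plays the role of the norm of the
`k`-th exterior power of `T`. It equals the product of the first `k` singular values
(`prod_singularValue_eq_maxVolume`) and is submultiplicative (`maxVolume_comp_le`). Since `omegaD`
is a geometric mean of the volumes of orders `m` and `m + 1` (`omegaD_eq_maxVolume`), it is
submultiplicative too. Along the cocycle the logarithm of its supremum over the base is subadditive
in time, and Fekete's lemma gives the limit.

The estimate is a Liouville-type inequality. Along a trajectory, the logarithm of the Gram
determinant of vectors from `N q` is absolutely continuous for as long as they stay independent, and
half of its derivative is at most a trace sum (`half_deriv_log_gramDet_le`). To see this at a given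
moment, pass to an orthonormal basis of the current span. By the inequality between geometric and
arithmetic means, the Gram determinant lies below a power of the mean squared norm, and the two
agree at that moment. Hence only squared norms need derivatives, and these are given by the mean
representation. Integration, a change of norms at the cost of `(b / a) ^ d`, and density of `N q`
bound `omegaD` at time `t` (`omegaD_cocycle_le`). The constant disappears after division of
logarithms by `t`.

The volumes of orders `m` and `m + 1` are estimated jointly, because the combination `(1 - γ) τ_m +
γ τ_{m+1}` of trace sums is what `fractionalTraceSum` controls.

The suprema of the time integrals are subadditive as well. The upper bound that Fekete's lemma
requires follows from their eventual finiteness by a Baire category argument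
(`exists_bound_of_iSup_continuous`). -/

noncomputable section

/-! ### Gram determinants with respect to an inner product -/

section GramDet

variable {𝕜 V : Type*} [RCLike 𝕜] [AddCommGroup V] [Module 𝕜 V] {k : ℕ}

/-- The Gram determinant of a family of vectors with respect to the inner product `c`. -/
def gramDet (c : InnerProductSpace.Core 𝕜 V) (v : Fin k → V) : ℝ :=
  RCLike.re (Matrix.of fun i j => c.inner (v i) (v j)).det

/-- The family `e` is orthonormal with respect to the inner product `c`. -/
def CoreOrthonormal (c : InnerProductSpace.Core 𝕜 V) (e : Fin k → V) : Prop :=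
  ∀ i j, c.inner (e i) (e j) = if i = j then 1 else 0

open scoped ComplexOrder in
theorem gramMatrix_posSemidef (c : InnerProductSpace.Core 𝕜 V) (v : Fin k → V) :
    (Matrix.of fun i j => c.inner (v i) (v j)).PosSemidef := by
  let _ : NormedAddCommGroup V := c.toNormedAddCommGroup
  let _ : InnerProductSpace 𝕜 V := InnerProductSpace.ofCore c.toCore
  exact Matrix.posSemidef_gram 𝕜 v

open scoped ComplexOrder in
theorem ofReal_gramDet (c : InnerProductSpace.Core 𝕜 V) (v : Fin k → V) :
    ((gramDet c v : ℝ) : 𝕜) = (Matrix.of fun i j => c.inner (v i) (v j)).det :=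
  (RCLike.nonneg_iff_exists_ofReal.1 (gramMatrix_posSemidef c v).det_nonneg).elim fun r hr => by
    rw [gramDet, ← hr.2, RCLike.ofReal_re]

open scoped ComplexOrder in
theorem gramDet_nonneg (c : InnerProductSpace.Core 𝕜 V) (v : Fin k → V) : 0 ≤ gramDet c v :=
  (RCLike.nonneg_iff.1 (gramMatrix_posSemidef c v).det_nonneg).1

theorem gramDet_pos_iff (c : InnerProductSpace.Core 𝕜 V) (v : Fin k → V) :
    0 < gramDet c v ↔ LinearIndependent 𝕜 v := by
  let _ : NormedAddCommGroup V := c.toNormedAddCommGroup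
  let _ : InnerProductSpace 𝕜 V := InnerProductSpace.ofCore c.toCore
  rw [← Matrix.det_gram_ne_zero_iff_linearIndependent (𝕜 := 𝕜) (v := v),
    (gramDet_nonneg c v).lt_iff_ne']
  exact (RCLike.ofReal_ne_zero (K := 𝕜)).symm.trans (by rw [ofReal_gramDet]; rfl)

theorem gramDet_eq_zero (c : InnerProductSpace.Core 𝕜 V) {v : Fin k → V}
    (hv : ¬ LinearIndependent 𝕜 v) : gramDet c v = 0 :=
  ((gramDet_nonneg c v).eq_of_not_lt (mt (gramDet_pos_iff c v).1 hv)).symm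

theorem CoreOrthonormal.gramDet_eq_one {c : InnerProductSpace.Core 𝕜 V} {e : Fin k → V}
    (he : CoreOrthonormal c e) : gramDet c e = 1 := by
  have : (Matrix.of fun i j => c.inner (e i) (e j)) = 1 := by
    ext i j
    rw [Matrix.of_apply, he i j, Matrix.one_apply]
  rw [gramDet, this, Matrix.det_one, RCLike.one_re]

theorem CoreOrthonormal.linearIndependent {c : InnerProductSpace.Core 𝕜 V} {e : Fin k → V}
    (he : CoreOrthonormal c e) : LinearIndependent 𝕜 e :=
  (gramDet_pos_iff c e).1 (he.gramDet_eq_one ▸ one_pos)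

/-- Every finite-dimensional subspace has an orthonormal basis. -/
theorem exists_coreOrthonormal (c : InnerProductSpace.Core 𝕜 V) (L : Submodule 𝕜 V)
    [FiniteDimensional 𝕜 L] (hL : Module.finrank 𝕜 L = k) :
    ∃ e : Fin k → V, CoreOrthonormal c e ∧ Submodule.span 𝕜 (Set.range e) = L := by
  let _ : NormedAddCommGroup V := c.toNormedAddCommGroup
  let _ : InnerProductSpace 𝕜 V := InnerProductSpace.ofCore c.toCore
  let b : OrthonormalBasis (Fin k) 𝕜 L := (stdOrthonormalBasis 𝕜 L).reindex (finCongr hL)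
  refine ⟨fun i => b i, fun i j => ?_, ?_⟩
  · exact orthonormal_iff_ite.1 b.orthonormal i j
  · have h := b.toBasis.span_eq
    have h2 := congrArg (Submodule.map L.subtype) h
    rw [Submodule.map_span, Submodule.map_top, Submodule.range_subtype, ← Set.range_comp] at h2
    refine Eq.trans ?_ h2
    congr 2

/-- A linearly independent family is expressed through an orthonormal basis of its span. -/
theorem exists_coreOrthonormal_of_linearIndependent (c : InnerProductSpace.Core 𝕜 V)
    {v : Fin k → V} (hv : LinearIndependent 𝕜 v) :
    ∃ (e : Fin k → V) (P : Matrix (Fin k) (Fin k) 𝕜), CoreOrthonormal c e ∧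
      Submodule.span 𝕜 (Set.range e) = Submodule.span 𝕜 (Set.range v) ∧
      v = fun i => ∑ j, P i j • e j := by
  have hfin : FiniteDimensional 𝕜 (Submodule.span 𝕜 (Set.range v)) :=
    FiniteDimensional.span_of_finite 𝕜 (Set.finite_range v)
  obtain ⟨e, he, hspan⟩ := exists_coreOrthonormal c (Submodule.span 𝕜 (Set.range v)) (k := k)
    (by rw [finrank_span_eq_card hv, Fintype.card_fin])
  have h : ∀ i, ∃ p : Fin k → 𝕜, ∑ j, p j • e j = v i := fun i =>
    (Submodule.mem_span_range_iff_exists_fun 𝕜).1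
      (hspan ▸ Submodule.subset_span (Set.mem_range_self i))
  choose P hP using h
  exact ⟨e, P, he, hspan, funext fun i => (hP i).symm⟩

theorem core_inner_sum_smul (c : InnerProductSpace.Core 𝕜 V) (x y : Fin k → 𝕜) (w : Fin k → V) :
    c.inner (∑ i, x i • w i) (∑ j, y j • w j)
      = ∑ i, ∑ j, starRingEnd 𝕜 (x i) * y j * c.inner (w i) (w j) := by
  let _ : NormedAddCommGroup V := c.toNormedAddCommGroup
  let _ : InnerProductSpace 𝕜 V := InnerProductSpace.ofCore c.toCore
  change inner 𝕜 (∑ i, x i • w i) (∑ j, y j • w j) = ∑ i, ∑ j, _ * _ * inner 𝕜 (w i) (w j)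
  simp_rw [sum_inner, inner_sum, inner_smul_left, inner_smul_right, mul_assoc]

/-- The Gram matrix `G` becomes `P̄ G Pᵀ`. The factor does not depend on the inner product or on
`w`, so a family and its image under a linear map scale alike; this permits free changes of basis.
-/
theorem gramDet_sum_smul (c : InnerProductSpace.Core 𝕜 V) (P : Matrix (Fin k) (Fin k) 𝕜)
    (w : Fin k → V) :
    gramDet c (fun i => ∑ j, P i j • w j) = ‖P.det‖ ^ 2 * gramDet c w := by
  have h : (Matrix.of fun i j => c.inner (∑ a, P i a • w a) (∑ b, P j b • w b))
      = P.map (starRingEnd 𝕜) * (Matrix.of fun i j => c.inner (w i) (w j)) * P.transpose := by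
    ext i j
    rw [Matrix.of_apply, core_inner_sum_smul, Matrix.mul_apply, Finset.sum_comm]
    refine Finset.sum_congr rfl fun b _ => ?_
    rw [Matrix.mul_apply, Finset.sum_mul]
    refine Finset.sum_congr rfl fun a _ => ?_
    simp only [Matrix.map_apply, Matrix.of_apply, Matrix.transpose_apply]
    ring
  have h2 : (P.map (starRingEnd 𝕜)).det = starRingEnd 𝕜 P.det :=
    ((starRingEnd 𝕜).map_det P).symm
  have h3 : ((gramDet c (fun i => ∑ j, P i j • w j) : ℝ) : 𝕜)
      = ((‖P.det‖ ^ 2 * gramDet c w : ℝ) : 𝕜) := by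
    rw [ofReal_gramDet, h, Matrix.det_mul, Matrix.det_mul, Matrix.det_transpose, h2,
      ← ofReal_gramDet, RCLike.ofReal_mul, RCLike.ofReal_pow, ← RCLike.conj_mul]
    ring
  exact RCLike.ofReal_injective h3

open scoped ComplexOrder in
/-- The Gram determinant is bounded by the power of the mean of the squared norms. -/
theorem gramDet_le_mean_pow (c : InnerProductSpace.Core 𝕜 V) (v : Fin k → V) :
    gramDet c v ≤ ((∑ i, RCLike.re (c.inner (v i) (v i))) / k) ^ k := by
  rcases Nat.eq_zero_or_pos k with rfl | hk
  · simp [gramDet]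
  have hG := gramMatrix_posSemidef c v
  set G := Matrix.of fun i j => c.inner (v i) (v j) with hGdef
  have hdet : gramDet c v = ∏ i, hG.1.eigenvalues i := by
    apply RCLike.ofReal_injective (K := 𝕜)
    rw [ofReal_gramDet, ← hGdef, hG.1.det_eq_prod_eigenvalues, RCLike.ofReal_prod]
  have htr : ∑ i, RCLike.re (c.inner (v i) (v i)) = ∑ i, hG.1.eigenvalues i := by
    have := congrArg RCLike.re hG.1.trace_eq_sum_eigenvalues
    rw [Matrix.trace, map_sum] at this
    simpa [hGdef] using this
  have hk' : (0 : ℝ) < k := Nat.cast_pos.2 hk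
  -- The eigenvalues of the Gram matrix are nonnegative, with the determinant as product and the sum
  -- of squared norms as sum.
  have := Real.geom_mean_le_arith_mean Finset.univ (fun _ => (1 : ℝ)) hG.1.eigenvalues
    (fun _ _ => zero_le_one) (by simpa using hk') (fun i _ => hG.eigenvalues_nonneg i)
  simp only [Real.rpow_one, Finset.sum_const, Finset.card_univ, Fintype.card_fin, nsmul_eq_mul,
    mul_one, one_mul] at this
  rw [hdet, htr]
  have hnn : 0 ≤ ∏ i, hG.1.eigenvalues i := Finset.prod_nonneg fun i _ => hG.eigenvalues_nonneg i
  calc ∏ i, hG.1.eigenvalues i = ((∏ i, hG.1.eigenvalues i) ^ ((k : ℝ)⁻¹)) ^ k := by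
        rw [Real.rpow_inv_natCast_pow hnn hk.ne']
    _ ≤ _ := by gcongr

/-- After reduction to a `c`-orthonormal family the mean of the squared `c'`-norms is at most `M`,
so `gramDet_le_mean_pow` applies. Dependent families give zero on both sides. -/
theorem gramDet_le_of_core_le {c c' : InnerProductSpace.Core 𝕜 V} {M : ℝ}
    (h : ∀ x, RCLike.re (c'.inner x x) ≤ M * RCLike.re (c.inner x x)) (v : Fin k → V) :
    gramDet c' v ≤ M ^ k * gramDet c v := by
  by_cases hv : LinearIndependent 𝕜 v
  · obtain ⟨e, P, he, -, rfl⟩ := exists_coreOrthonormal_of_linearIndependent c hv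
    rw [gramDet_sum_smul, gramDet_sum_smul, he.gramDet_eq_one, mul_one, mul_comm]
    gcongr
    refine (gramDet_le_mean_pow c' e).trans ?_
    rcases Nat.eq_zero_or_pos k with rfl | hk
    · simp
    have hk' : (0 : ℝ) < k := Nat.cast_pos.2 hk
    gcongr
    · exact div_nonneg (Finset.sum_nonneg fun i _ => c'.re_inner_nonneg _) hk'.le
    · rw [div_le_iff₀ hk']
      calc ∑ i, RCLike.re (c'.inner (e i) (e i)) ≤ ∑ _i : Fin k, M := by
            refine Finset.sum_le_sum fun i _ => (h _).trans ?_
            rw [he i i, if_pos rfl, RCLike.one_re, mul_one]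
        _ = M * k := by simp [mul_comm]
  · rw [gramDet_eq_zero _ hv, gramDet_eq_zero _ hv, mul_zero]

end GramDet

/-! ### Trace numbers -/

section TraceNumbers

variable {𝕜 V : Type*} [RCLike 𝕜] [AddCommGroup V] [Module 𝕜 V] {k : ℕ}

/-- The trace of the compression to `L` through an orthonormal basis of `L`. -/
theorem reTrace_eq_sum (c : InnerProductSpace.Core 𝕜 V) (A : V →ₗ.[𝕜] V) (L : Submodule 𝕜 V)
    [FiniteDimensional 𝕜 L] (hL : L ≤ A.domain) {e : Fin k → A.domain}
    (he : CoreOrthonormal c fun i => (e i : V))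
    (hspan : Submodule.span 𝕜 (Set.range fun i => (e i : V)) = L) :
    reTrace c A L hL = ∑ i, RCLike.re (c.inner (e i : V) (A (e i))) := by
  let _ : NormedAddCommGroup V := c.toNormedAddCommGroup
  let _ : InnerProductSpace 𝕜 V := InnerProductSpace.ofCore c.toCore
  have hmem : ∀ i, (e i : V) ∈ L := fun i =>
    hspan ▸ Submodule.subset_span (Set.mem_range_self i)
  let v : Fin k → L := fun i => ⟨e i, hmem i⟩
  have hv : Orthonormal 𝕜 v := orthonormal_iff_ite.2 he
  have hsp : ⊤ ≤ Submodule.span 𝕜 (Set.range v) := by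
    rw [← Submodule.map_le_map_iff_of_injective L.injective_subtype, Submodule.map_top,
      Submodule.range_subtype, Submodule.map_span, ← Set.range_comp]
    exact hspan.symm.le
  let b : OrthonormalBasis (Fin k) 𝕜 L := OrthonormalBasis.mk hv hsp
  have hb : ∀ i, b i = v i := fun i => congrFun (OrthonormalBasis.coe_mk hv hsp) i
  unfold reTrace
  rw [LinearMap.trace_eq_sum_inner _ b, map_sum]
  refine Finset.sum_congr rfl fun i _ => congrArg _ ?_
  rw [hb i]
  exact Submodule.inner_orthogonalProjectionOnto_eq_of_mem_left (v i) (A (e i))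

theorem reTrace_le_traceSum (c : InnerProductSpace.Core 𝕜 V) (A : V →ₗ.[𝕜] V)
    (L : Submodule 𝕜 V) [hfin : FiniteDimensional 𝕜 L] (hL : L ≤ A.domain)
    (hk : Module.finrank 𝕜 L = k) : ((reTrace c A L hL : ℝ) : EReal) ≤ traceSum c A k :=
  le_iSup_of_le L <| le_iSup_of_le hfin <| le_iSup_of_le hL <| le_iSup_of_le hk le_rfl

theorem sum_re_inner_le_traceSum (c : InnerProductSpace.Core 𝕜 V) (A : V →ₗ.[𝕜] V)
    {e : Fin k → A.domain} (he : CoreOrthonormal c fun i => (e i : V)) :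
    ((∑ i, RCLike.re (c.inner (e i : V) (A (e i))) : ℝ) : EReal) ≤ traceSum c A k := by
  have hfin : FiniteDimensional 𝕜 (Submodule.span 𝕜 (Set.range fun i => (e i : V))) :=
    FiniteDimensional.span_of_finite 𝕜 (Set.finite_range _)
  have hL : Submodule.span 𝕜 (Set.range fun i => (e i : V)) ≤ A.domain :=
    Submodule.span_le.2 (Set.range_subset_iff.2 fun i => (e i).2)
  rw [← reTrace_eq_sum c A _ hL he rfl]
  refine reTrace_le_traceSum c A _ hL ?_
  rw [finrank_span_eq_card he.linearIndependent, Fintype.card_fin]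

theorem traceSum_le_of_forall_sum_re_inner_le (c : InnerProductSpace.Core 𝕜 V) (A : V →ₗ.[𝕜] V)
    {M : EReal} (h : ∀ e : Fin k → A.domain, (CoreOrthonormal c fun i => (e i : V)) →
      ((∑ i, RCLike.re (c.inner (e i : V) (A (e i))) : ℝ) : EReal) ≤ M) :
    traceSum c A k ≤ M := by
  refine iSup_le fun L => iSup_le fun _ => iSup_le fun hL => iSup_le fun hk => ?_
  obtain ⟨e, he, hspan⟩ := exists_coreOrthonormal c L hk
  let e' : Fin k → A.domain := fun i =>
    ⟨e i, hL (hspan ▸ Submodule.subset_span (Set.mem_range_self i))⟩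
  rw [reTrace_eq_sum c A L hL (e := e') he hspan]
  exact h e' he

theorem traceSum_zero (c : InnerProductSpace.Core 𝕜 V) (A : V →ₗ.[𝕜] V) :
    traceSum c A 0 = 0 := by
  refine le_antisymm (traceSum_le_of_forall_sum_re_inner_le c A fun e _ => by simp) ?_
  have := sum_re_inner_le_traceSum c A (e := (Fin.elim0 : Fin 0 → A.domain)) fun i => i.elim0
  simpa using this

theorem exists_coreOrthonormal_mem (c : InnerProductSpace.Core 𝕜 V) {D : Submodule 𝕜 V}
    {v : Fin k → V} (hv : LinearIndependent 𝕜 v) (hvD : ∀ i, v i ∈ D) :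
    ∃ e : Fin k → D, CoreOrthonormal c fun i => (e i : V) := by
  obtain ⟨e, -, he, hspan, -⟩ := exists_coreOrthonormal_of_linearIndependent c hv
  have hD : Submodule.span 𝕜 (Set.range v) ≤ D :=
    Submodule.span_le.2 (Set.range_subset_iff.2 hvD)
  exact ⟨fun i => ⟨e i, hD (hspan ▸ Submodule.subset_span (Set.mem_range_self i))⟩, he⟩

theorem traceSum_ne_bot (c : InnerProductSpace.Core 𝕜 V) (A : V →ₗ.[𝕜] V) {v : Fin k → V}
    (hv : LinearIndependent 𝕜 v) (hvA : ∀ i, v i ∈ A.domain) : traceSum c A k ≠ ⊥ := by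
  obtain ⟨e, he⟩ := exists_coreOrthonormal_mem c hv hvA
  exact ((EReal.bot_lt_coe _).trans_le (sum_re_inner_le_traceSum c A he)).ne'

/-- An orthonormal family of `k` vectors is extended by a combination of a given orthonormal
family of `k + 1` vectors with coefficients bounded by `1`. -/
theorem exists_coreOrthonormal_cons (c : InnerProductSpace.Core 𝕜 V) {f : Fin (k + 1) → V}
    (hf : CoreOrthonormal c f) {e : Fin k → V} (he : CoreOrthonormal c e) :
    ∃ x : Fin (k + 1) → 𝕜, (∀ i, ‖x i‖ ≤ 1) ∧
      CoreOrthonormal c (Fin.cons (∑ i, x i • f i) e : Fin (k + 1) → V) := by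
  let _ : NormedAddCommGroup V := c.toNormedAddCommGroup
  let _ : InnerProductSpace 𝕜 V := InnerProductSpace.ofCore c.toCore
  -- Orthogonality to `e` imposes `k` linear conditions on `k + 1` coefficients, so a nonzero
  -- solution exists.
  let φ : (Fin (k + 1) → 𝕜) →ₗ[𝕜] (Fin k → 𝕜) :=
    Matrix.mulVecLin (Matrix.of fun i j => c.inner (e i) (f j))
  have hker : LinearMap.ker φ ≠ ⊥ := LinearMap.ker_ne_bot_of_finrank_lt (by simp)
  obtain ⟨y, hy, hy0⟩ := Submodule.exists_mem_ne_zero_of_ne_bot hker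
  set r : ℝ := ∑ i, ‖y i‖ ^ 2 with hr
  have hr0 : 0 < r := by
    obtain ⟨i, hi⟩ := Function.ne_iff.1 hy0
    refine Finset.sum_pos' (fun _ _ => by positivity) ⟨i, Finset.mem_univ _, ?_⟩
    have : 0 < ‖y i‖ := norm_pos_iff.2 hi
    positivity
  have hs0 : 0 < √r := Real.sqrt_pos.2 hr0
  let x : Fin (k + 1) → 𝕜 := fun i => ((√r)⁻¹ : ℝ) * y i
  have hxn : ∀ i, ‖x i‖ = (√r)⁻¹ * ‖y i‖ := fun i => by
    simp only [x, norm_mul, RCLike.norm_ofReal, abs_of_pos (inv_pos.2 hs0)]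
  have hsum : ∑ i, ‖x i‖ ^ 2 = 1 := by
    simp only [hxn, mul_pow, ← Finset.mul_sum, ← hr, inv_pow, Real.sq_sqrt hr0.le]
    exact inv_mul_cancel₀ hr0.ne'
  have huu : c.inner (∑ i, x i • f i) (∑ i, x i • f i) = 1 := by
    rw [core_inner_sum_smul]
    simp only [hf _ _, mul_ite, mul_one, mul_zero, Finset.sum_ite_eq, Finset.mem_univ, if_true,
      RCLike.conj_mul]
    exact_mod_cast congrArg (fun r : ℝ => (r : 𝕜)) hsum
  have heu : ∀ i, c.inner (e i) (∑ j, x j • f j) = 0 := fun i => by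
    have h1 : ∑ j, c.inner (e i) (f j) * y j = 0 := congrFun (LinearMap.mem_ker.1 hy) i
    change inner 𝕜 (e i) (∑ j, x j • f j) = 0
    rw [inner_sum]
    simp only [inner_smul_right, x, mul_assoc]
    rw [← Finset.mul_sum]
    refine mul_eq_zero_of_right _ (Eq.trans (Finset.sum_congr rfl fun j _ => mul_comm _ _) h1)
  have hue : ∀ i, c.inner (∑ j, x j • f j) (e i) = 0 := fun i => by
    rw [← c.conj_inner_symm, heu, map_zero]
  refine ⟨x, fun i => ?_, fun i j => ?_⟩
  · have : ‖x i‖ ^ 2 ≤ 1 := hsum ▸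
      Finset.single_le_sum (f := fun i => ‖x i‖ ^ 2) (fun _ _ => by positivity) (Finset.mem_univ i)
    exact (sq_le_one_iff₀ (norm_nonneg _)).1 this
  · refine Fin.cases ?_ (fun i => ?_) i <;> refine Fin.cases ?_ (fun j => ?_) j
    · simpa using huu
    · simpa [(Fin.succ_ne_zero j).symm] using hue j
    · simpa [Fin.succ_ne_zero i] using heu i
    · simpa using he i j

/-- Every orthonormal `k`-family can be extended by a unit vector `u` from the span of one fixed
orthonormal `(k + 1)`-family `f`. There `Re ⟨u, A u⟩ ≥ -C` with `C` depending only on `f`, so the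
order-`k` sums are at most the order-`(k + 1)` supremum plus `C`. This excludes `∞ - ∞` in the trace
numbers. -/
theorem traceSum_ne_top_of_succ (c : InnerProductSpace.Core 𝕜 V) (A : V →ₗ.[𝕜] V)
    {v : Fin (k + 1) → V} (hv : LinearIndependent 𝕜 v) (hvA : ∀ i, v i ∈ A.domain)
    (h : traceSum c A (k + 1) ≠ ⊤) : traceSum c A k ≠ ⊤ := by
  obtain ⟨f, hf⟩ := exists_coreOrthonormal_mem c hv hvA
  have hbot := traceSum_ne_bot c A hv hvA
  lift traceSum c A (k + 1) to ℝ using ⟨h, hbot⟩ with S hS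
  let _ : NormedAddCommGroup V := c.toNormedAddCommGroup
  let _ : InnerProductSpace 𝕜 V := InnerProductSpace.ofCore c.toCore
  set C : ℝ := ∑ i, ∑ j, ‖c.inner (f i : V) (A (f j))‖ with hC
  refine ((traceSum_le_of_forall_sum_re_inner_le c A (M := ((S + C : ℝ) : EReal))
    fun e he => ?_).trans_lt (EReal.coe_lt_top _)).ne
  obtain ⟨x, hx, hcons⟩ := exists_coreOrthonormal_cons c hf he
  let u : A.domain := ∑ i, x i • f i
  have hu : (u : V) = ∑ i, x i • (f i : V) := by simp [u]
  have hAu : A u = ∑ j, x j • A (f j) := by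
    change A.toFun u = ∑ j, x j • A.toFun (f j)
    simp [u, map_sum]
  let e' : Fin (k + 1) → A.domain := Fin.cons u e
  have hcoe : (fun i => (e' i : V)) = Fin.cons (∑ i, x i • (f i : V)) fun i => (e i : V) := by
    funext i
    refine Fin.cases ?_ (fun i => ?_) i
    · simpa [e'] using hu
    · simp [e']
  have hle := sum_re_inner_le_traceSum c A (e := e') (hcoe ▸ hcons)
  rw [← hS, EReal.coe_le_coe_iff, Fin.sum_univ_succ] at hle
  simp only [e', Fin.cons_zero, Fin.cons_succ] at hle
  have hbound : -C ≤ RCLike.re (c.inner (u : V) (A u)) := by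
    refine (abs_le.1 ((RCLike.abs_re_le_norm _).trans ?_)).1
    have : c.inner (u : V) (A u)
        = ∑ i, ∑ j, starRingEnd 𝕜 (x i) * (x j * c.inner (f i : V) (A (f j))) := by
      rw [hu, hAu]
      change inner 𝕜 (∑ i, x i • (f i : V)) (∑ j, x j • A (f j)) = _
      simp_rw [sum_inner, inner_sum, inner_smul_left, inner_smul_right]
    rw [this]
    refine (norm_sum_le _ _).trans (Finset.sum_le_sum fun i _ =>
      (norm_sum_le _ _).trans (Finset.sum_le_sum fun j _ => ?_))
    rw [norm_mul, norm_mul, RCLike.norm_conj, ← mul_assoc]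
    exact mul_le_of_le_one_left (norm_nonneg _) (mul_le_one₀ (hx i) (norm_nonneg _) (hx j))
  rw [EReal.coe_le_coe_iff]
  linarith

/-- The sum telescopes: independent vectors in the domain keep the trace sums away from `-∞`, and
once one of them is `+∞` so are the later ones. -/
theorem sum_traceNumber (c : InnerProductSpace.Core 𝕜 V) (A : V →ₗ.[𝕜] V) {m : ℕ}
    {v : Fin m → V} (hv : LinearIndependent 𝕜 v) (hvA : ∀ i, v i ∈ A.domain) :
    ∑ j ∈ Finset.Icc 1 m, traceNumber c A j = traceSum c A m := by
  induction m with
  | zero => simp [traceSum_zero]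
  | succ m ih =>
    have hv' : LinearIndependent 𝕜 (v ∘ Fin.castSucc) := hv.comp _ (Fin.castSucc_injective m)
    have hvA' : ∀ i, (v ∘ Fin.castSucc) i ∈ A.domain := fun i => hvA _
    rw [Finset.sum_Icc_succ_top (Nat.le_add_left 1 m), ih hv' hvA', traceNumber]
    have hbot := traceSum_ne_bot c A hv' hvA'
    split_ifs with h
    · rw [h, EReal.add_top_of_ne_bot hbot]
    · have htop := traceSum_ne_top_of_succ c A hv hvA h
      have hbot' := traceSum_ne_bot c A hv hvA
      lift traceSum c A m to ℝ using ⟨htop, hbot⟩ with a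
      lift traceSum c A (m + 1) to ℝ using ⟨h, hbot'⟩ with b
      norm_cast
      ring

theorem fractionalTraceSum_zero (c : InnerProductSpace.Core 𝕜 V) (A : V →ₗ.[𝕜] V) {m : ℕ}
    {v : Fin m → V} (hv : LinearIndependent 𝕜 v) (hvA : ∀ i, v i ∈ A.domain) :
    fractionalTraceSum c A m 0 = traceSum c A m := by
  rw [fractionalTraceSum, sum_traceNumber c A hv hvA, EReal.coe_zero, zero_mul, add_zero]

theorem fractionalTraceSum_one (c : InnerProductSpace.Core 𝕜 V) (A : V →ₗ.[𝕜] V) (m : ℕ) :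
    fractionalTraceSum c A m 1 = fractionalTraceSum c A (m + 1) 0 := by
  rw [fractionalTraceSum, fractionalTraceSum, EReal.coe_one, one_mul, EReal.coe_zero, zero_mul,
    add_zero, Finset.sum_Icc_succ_top (Nat.le_add_left 1 m)]

/-- The fractional trace sum dominates the convex combinations of two consecutive trace sums. -/
theorem le_fractionalTraceSum (c : InnerProductSpace.Core 𝕜 V) (A : V →ₗ.[𝕜] V) {m : ℕ} {γ : ℝ}
    (hγ₀ : 0 < γ) (hγ₁ : γ ≤ 1) {v : Fin (m + 1) → V} (hv : LinearIndependent 𝕜 v)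
    (hvA : ∀ i, v i ∈ A.domain) {x y : ℝ} (hx : (x : EReal) ≤ traceSum c A m)
    (hy : (y : EReal) ≤ traceSum c A (m + 1)) :
    (((1 - γ) * x + γ * y : ℝ) : EReal) ≤ fractionalTraceSum c A m γ := by
  have hv' : LinearIndependent 𝕜 (v ∘ Fin.castSucc) := hv.comp _ (Fin.castSucc_injective m)
  have hvA' : ∀ i, (v ∘ Fin.castSucc) i ∈ A.domain := fun i => hvA _
  have hbot := traceSum_ne_bot c A hv' hvA'
  rw [fractionalTraceSum, sum_traceNumber c A hv' hvA', traceNumber]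
  split_ifs with h
  · rw [EReal.coe_mul_top_of_pos hγ₀, EReal.add_top_of_ne_bot hbot]
    exact le_top
  -- Both trace sums are finite here, and the right side is exactly `(1 - γ) * a + γ * b`.
  · have htop := traceSum_ne_top_of_succ c A hv hvA h
    have hbot' := traceSum_ne_bot c A hv hvA
    lift traceSum c A m to ℝ using ⟨htop, hbot⟩ with a
    lift traceSum c A (m + 1) to ℝ using ⟨h, hbot'⟩ with b
    norm_cast at hx hy ⊢
    have := mul_le_mul_of_nonneg_left hx (sub_nonneg.2 hγ₁)
    have := mul_le_mul_of_nonneg_left hy hγ₀.le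
    linarith

end TraceNumbers

/-! ### Singular values and volumes -/

section SingularValues

variable {𝕜 H : Type*} [RCLike 𝕜] [NormedAddCommGroup H] [InnerProductSpace 𝕜 H] {k : ℕ}

theorem coreOrthonormal_toCore_iff {e : Fin k → H} :
    CoreOrthonormal (InnerProductSpace.toCore (𝕜 := 𝕜)) e ↔ Orthonormal 𝕜 e :=
  orthonormal_iff_ite.symm

theorem gramDet_map_sum_smul (c : InnerProductSpace.Core 𝕜 H) (T : H →ₗ[𝕜] H)
    (P : Matrix (Fin k) (Fin k) 𝕜) (w : Fin k → H) :
    gramDet c (fun i => T (∑ j, P i j • w j)) = ‖P.det‖ ^ 2 * gramDet c (fun i => T (w i)) := by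
  simp only [map_sum, map_smul]
  exact gramDet_sum_smul c P fun i => T (w i)

theorem norm_sq_map_sum_smul {T : H →L[𝕜] H} {e : Fin k → H} {s : Fin k → ℝ}
    (hT : ∀ i j, inner 𝕜 (T (e i)) (T (e j)) = if i = j then ((s i ^ 2 : ℝ) : 𝕜) else 0)
    (x : Fin k → 𝕜) : ‖T (∑ i, x i • e i)‖ ^ 2 = ∑ i, ‖x i‖ ^ 2 * s i ^ 2 := by
  apply RCLike.ofReal_injective (K := 𝕜)
  rw [RCLike.ofReal_pow, ← inner_self_eq_norm_sq_to_K, map_sum]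
  simp only [map_smul]
  refine (core_inner_sum_smul InnerProductSpace.toCore x x fun i => T (e i)).trans ?_
  change ∑ i, ∑ j, _ * _ * inner 𝕜 (T (e i)) (T (e j)) = _
  simp [hT, RCLike.conj_mul]

theorem Orthonormal.norm_sq_sum_smul {e : Fin k → H} (he : Orthonormal 𝕜 e) (x : Fin k → 𝕜) :
    ‖∑ i, x i • e i‖ ^ 2 = ∑ i, ‖x i‖ ^ 2 := by
  have := norm_sq_map_sum_smul (T := ContinuousLinearMap.id 𝕜 H) (e := e) (s := fun _ => 1)
    (fun i j => by simpa using orthonormal_iff_ite.1 he i j) x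
  simpa using this

theorem gramDet_map_eq_prod {T : H →L[𝕜] H} {e : Fin k → H} {s : Fin k → ℝ}
    (hT : ∀ i j, inner 𝕜 (T (e i)) (T (e j)) = if i = j then ((s i ^ 2 : ℝ) : 𝕜) else 0) :
    gramDet (InnerProductSpace.toCore (𝕜 := 𝕜)) (fun i => T (e i)) = (∏ i, s i) ^ 2 := by
  have h : (Matrix.of fun i j =>
      (InnerProductSpace.toCore (𝕜 := 𝕜)).inner (T (e i)) (T (e j)))
      = Matrix.diagonal fun i => ((s i ^ 2 : ℝ) : 𝕜) := by
    ext i j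
    rw [Matrix.of_apply, Matrix.diagonal_apply]
    exact hT i j
  apply RCLike.ofReal_injective (K := 𝕜)
  rw [ofReal_gramDet, h, Matrix.det_diagonal, ← Finset.prod_pow, RCLike.ofReal_prod]

/-- Singular value decomposition of the restriction of an operator to a finite-dimensional
subspace. -/
theorem exists_singular_basis [CompleteSpace H] (T : H →L[𝕜] H) (L : Submodule 𝕜 H)
    [FiniteDimensional 𝕜 L] (hk : Module.finrank 𝕜 L = k) :
    ∃ (e : Fin k → H) (s : Fin k → ℝ), Orthonormal 𝕜 e ∧
      Submodule.span 𝕜 (Set.range e) = L ∧ Antitone s ∧ (∀ i, 0 ≤ s i) ∧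
      ∀ i j, inner 𝕜 (T (e i)) (T (e j)) = if i = j then ((s i ^ 2 : ℝ) : 𝕜) else 0 := by
  have : CompleteSpace L := FiniteDimensional.complete 𝕜 L
  let T' : L →L[𝕜] H := T.comp L.subtypeL
  -- Orthonormal eigenvectors of `T'* T'` have orthogonal images; the square roots of the
  -- eigenvalues are the lengths of these images.
  let S : L →L[𝕜] L := (ContinuousLinearMap.adjoint T').comp T'
  have hS : (S : L →ₗ[𝕜] L).IsSymmetric := fun x y => by
    simp [S, ContinuousLinearMap.adjoint_inner_left, ContinuousLinearMap.adjoint_inner_right]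
  let b := hS.eigenvectorBasis hk
  have hinner : ∀ i j, inner 𝕜 (T (b i : H)) (T (b j : H))
      = if i = j then (hS.eigenvalues hk i : 𝕜) else 0 := fun i j => by
    have h1 : inner 𝕜 (T (b i : H)) (T (b j : H)) = inner 𝕜 (S (b i)) (b j) :=
      (ContinuousLinearMap.adjoint_inner_left T' (b j) (T' (b i))).symm
    have h2 : S (b i) = (hS.eigenvalues hk i : 𝕜) • b i := hS.apply_eigenvectorBasis hk i
    rw [h1, h2, inner_smul_left, RCLike.conj_ofReal, orthonormal_iff_ite.1 b.orthonormal i j,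
      mul_ite, mul_one, mul_zero]
  have hnn : ∀ i, 0 ≤ hS.eigenvalues hk i := fun i => by
    have h := congrArg RCLike.re (hinner i i)
    rw [if_pos rfl, RCLike.ofReal_re] at h
    rw [← h]
    exact inner_self_nonneg
  refine ⟨fun i => b i, fun i => √(hS.eigenvalues hk i), ?_, ?_, ?_, ?_, ?_⟩
  · exact b.orthonormal.comp_linearIsometry L.subtypeₗᵢ
  · have h := congrArg (Submodule.map L.subtype) b.toBasis.span_eq
    rw [Submodule.map_span, Submodule.map_top, Submodule.range_subtype, ← Set.range_comp] at h
    refine Eq.trans ?_ h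
    congr 2
  · exact fun i j hij => Real.sqrt_le_sqrt (hS.eigenvalues_antitone hk hij)
  · exact fun i => Real.sqrt_nonneg _
  · intro i j
    rw [Real.sq_sqrt (hnn i)]
    exact hinner i j

/-- The supremum of the `k`-dimensional volumes of the images of the orthonormal families. -/
def maxVolume (k : ℕ) (T : H →L[𝕜] H) : ℝ≥0∞ :=
  ⨆ (e : Fin k → H) (_ : Orthonormal 𝕜 e),
    ENNReal.ofReal √(gramDet (InnerProductSpace.toCore (𝕜 := 𝕜)) fun i => T (e i))

/-- Both volumes scale by the same `|det P|` when `v` is expressed through an orthonormal basis of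
its span. Submultiplicativity of `maxVolume` follows at once. -/
theorem volume_map_le (T : H →L[𝕜] H) (v : Fin k → H) :
    ENNReal.ofReal √(gramDet (InnerProductSpace.toCore (𝕜 := 𝕜)) fun i => T (v i)) ≤
      maxVolume k T * ENNReal.ofReal √(gramDet (InnerProductSpace.toCore (𝕜 := 𝕜)) v) := by
  by_cases hv : LinearIndependent 𝕜 v
  · obtain ⟨e, P, he, -, rfl⟩ :=
      exists_coreOrthonormal_of_linearIndependent (InnerProductSpace.toCore (𝕜 := 𝕜)) hv
    have h1 := gramDet_map_sum_smul (InnerProductSpace.toCore (𝕜 := 𝕜)) (T : H →ₗ[𝕜] H) P e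
    have h2 := gramDet_sum_smul (InnerProductSpace.toCore (𝕜 := 𝕜)) P e
    rw [he.gramDet_eq_one, mul_one] at h2
    simp only [ContinuousLinearMap.coe_coe] at h1
    rw [h1, h2, Real.sqrt_mul (sq_nonneg _), ENNReal.ofReal_mul (Real.sqrt_nonneg _), mul_comm]
    gcongr
    exact le_iSup₂_of_le e (coreOrthonormal_toCore_iff.1 he) le_rfl
  · have : ¬ LinearIndependent 𝕜 fun i => T (v i) := fun h =>
      hv (LinearIndependent.of_comp (T : H →ₗ[𝕜] H) h)
    rw [gramDet_eq_zero _ this]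
    simp

theorem maxVolume_comp_le (S T : H →L[𝕜] H) :
    maxVolume k (S.comp T) ≤ maxVolume k S * maxVolume k T :=
  iSup₂_le fun e he => (volume_map_le S fun i => T (e i)).trans <| by
    gcongr
    exact le_iSup₂_of_le e he le_rfl

/-- Positivity of `k` matters: for `k = 0` the infimum is over no unit vectors and the value is `∞`.
-/
theorem singularValue_le_enorm (T : H →L[𝕜] H) (hk : 0 < k) : singularValue T k ≤ ‖T‖ₑ := by
  refine iSup_le fun L => iSup_le fun _ => iSup_le fun hL => ?_
  have : Nontrivial L := Module.nontrivial_of_finrank_pos (R := 𝕜) (hL ▸ hk)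
  obtain ⟨x, hx⟩ := exists_ne (0 : L)
  have hx' : (x : H) ≠ 0 := by simpa using hx
  let ξ : H := ((‖(x : H)‖⁻¹ : ℝ) : 𝕜) • (x : H)
  have hξ : ‖ξ‖ = 1 := by
    simp only [ξ, norm_smul, RCLike.norm_ofReal, abs_inv, abs_norm]
    exact inv_mul_cancel₀ (norm_ne_zero_iff.2 hx')
  refine iInf_le_of_le ξ (iInf_le_of_le (L.smul_mem _ x.2) (iInf_le_of_le hξ ?_))
  rw [← ofReal_norm, ← ofReal_norm]
  refine ENNReal.ofReal_le_ofReal ?_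
  simpa [hξ] using T.le_opNorm ξ

theorem prod_Icc_eq_prod_fin {M : Type*} [CommMonoid M] (f : ℕ → M) (m : ℕ) :
    ∏ j ∈ Finset.Icc 1 m, f j = ∏ i : Fin m, f (i + 1) := by
  induction m with
  | zero => simp
  | succ m ih =>
    rw [Finset.prod_Icc_succ_top (Nat.le_add_left 1 m), ih, Fin.prod_univ_castSucc]
    simp

/-- The passage from `v` to the singular basis `e` of its span has `|det| = 1`, so the volume is `∏
s i`. On the span of the first `j + 1` vectors of `e` unit vectors are stretched at least by `s j`,
so this span is a competitor in the definition of the singular value of order `j + 1`. -/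
theorem maxVolume_le_prod_singularValue [CompleteSpace H] (T : H →L[𝕜] H) :
    maxVolume k T ≤ ∏ i : Fin k, singularValue T (i + 1) := by
  refine iSup₂_le fun v hv => ?_
  have hvli := hv.linearIndependent
  have hfin : FiniteDimensional 𝕜 (Submodule.span 𝕜 (Set.range v)) :=
    FiniteDimensional.span_of_finite 𝕜 (Set.finite_range v)
  obtain ⟨e, s, he, hspan, hanti, hs, hT⟩ :=
    exists_singular_basis T (Submodule.span 𝕜 (Set.range v)) (k := k)
      (by rw [finrank_span_eq_card hvli, Fintype.card_fin])
  have h : ∀ i, ∃ p : Fin k → 𝕜, ∑ j, p j • e j = v i := fun i =>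
    (Submodule.mem_span_range_iff_exists_fun 𝕜).1
      (hspan ▸ Submodule.subset_span (Set.mem_range_self i))
  choose P hP using h
  have hvP : v = fun i => ∑ j, P i j • e j := funext fun i => (hP i).symm
  have hdet : ‖(Matrix.of P).det‖ ^ 2 = 1 := by
    have h1 := gramDet_sum_smul (InnerProductSpace.toCore (𝕜 := 𝕜)) (Matrix.of P) e
    rw [(coreOrthonormal_toCore_iff.2 he).gramDet_eq_one, mul_one] at h1
    rw [← h1, ← (coreOrthonormal_toCore_iff.2 hv).gramDet_eq_one]
    exact congrArg _ hvP.symm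
  have hvol : gramDet (InnerProductSpace.toCore (𝕜 := 𝕜)) (fun i => T (v i)) = (∏ i, s i) ^ 2 := by
    have h1 := gramDet_map_sum_smul (InnerProductSpace.toCore (𝕜 := 𝕜)) (T : H →ₗ[𝕜] H)
      (Matrix.of P) e
    rw [hdet, one_mul] at h1
    simp only [ContinuousLinearMap.coe_coe, Matrix.of_apply, hP] at h1
    rw [h1, gramDet_map_eq_prod hT]
  rw [hvol, Real.sqrt_sq (Finset.prod_nonneg fun i _ => hs i),
    ENNReal.ofReal_prod_of_nonneg fun i _ => hs i]
  refine Finset.prod_le_prod' fun j _ => ?_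
  let ι : Fin (j + 1) → Fin k := Fin.castLE j.2
  have hι : Function.Injective ι := Fin.castLE_injective j.2
  have heι : Orthonormal 𝕜 (e ∘ ι) := he.comp ι hι
  have hTι : ∀ a b, inner 𝕜 (T ((e ∘ ι) a)) (T ((e ∘ ι) b))
      = if a = b then (((s ∘ ι) a ^ 2 : ℝ) : 𝕜) else 0 := fun a b => by
    simpa [hι.eq_iff] using hT (ι a) (ι b)
  refine le_iSup_of_le (Submodule.span 𝕜 (Set.range (e ∘ ι))) <| le_iSup_of_le
    (FiniteDimensional.span_of_finite 𝕜 (Set.finite_range _)) <| le_iSup_of_le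
    (by rw [finrank_span_eq_card heι.linearIndependent, Fintype.card_fin]) ?_
  refine le_iInf fun ξ => le_iInf fun hξ => le_iInf fun hξ1 => ?_
  obtain ⟨x, rfl⟩ := (Submodule.mem_span_range_iff_exists_fun 𝕜).1 hξ
  rw [← ofReal_norm]
  refine ENNReal.ofReal_le_ofReal ((sq_le_sq₀ (hs j) (norm_nonneg _)).1 ?_)
  have h1 : ∑ i, ‖x i‖ ^ 2 = 1 := by rw [← heι.norm_sq_sum_smul, hξ1, one_pow]
  rw [norm_sq_map_sum_smul hTι]
  calc s j ^ 2 = ∑ i, ‖x i‖ ^ 2 * s j ^ 2 := by rw [← Finset.sum_mul, h1, one_mul]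
    _ ≤ _ := by
      refine Finset.sum_le_sum fun i _ => ?_
      gcongr
      · exact hs j
      · exact hanti (Fin.le_def.2 (Nat.lt_succ_iff.1 i.2))

/-- A min-max argument inside the finite-dimensional sum of nearly optimal subspaces `L i`. The
inequality in `ha` is strict because the suprema defining the singular values need not be attained.
-/
theorem prod_le_maxVolume [CompleteSpace H] (T : H →L[𝕜] H) {a : Fin k → ℝ≥0∞}
    (ha : ∀ i, a i < singularValue T (i + 1)) : ∏ i, a i ≤ maxVolume k T := by
  have hex : ∀ i : Fin k, ∃ L : Submodule 𝕜 H, FiniteDimensional 𝕜 L ∧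
      Module.finrank 𝕜 L = i + 1 ∧ ∀ ξ ∈ L, ‖ξ‖ = 1 → a i ≤ ‖T ξ‖ₑ := fun i => by
    obtain ⟨L, h⟩ := lt_iSup_iff.1 (ha i)
    obtain ⟨h1, h⟩ := lt_iSup_iff.1 h
    obtain ⟨h2, h⟩ := lt_iSup_iff.1 h
    exact ⟨L, h1, h2, fun ξ hξ hξ1 =>
      h.le.trans (iInf_le_of_le ξ (iInf_le_of_le hξ (iInf_le_of_le hξ1 le_rfl)))⟩
  choose L hfin hrank hL using hex
  have hfin' : FiniteDimensional 𝕜 (⨆ i, L i : Submodule 𝕜 H) := Submodule.finiteDimensional_iSup L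
  obtain ⟨e, s, he, hspan, hanti, hs, hT⟩ := exists_singular_basis T (⨆ i, L i) rfl
  have hle : k ≤ Module.finrank 𝕜 (⨆ i, L i : Submodule 𝕜 H) := by
    rcases k with _ | k
    · exact Nat.zero_le _
    · have := Submodule.finrank_mono (le_iSup L (Fin.last k))
      rwa [hrank, Fin.val_last] at this
  let ι : Fin k → Fin (Module.finrank 𝕜 (⨆ i, L i : Submodule 𝕜 H)) := Fin.castLE hle
  have hι : Function.Injective ι := Fin.castLE_injective hle
  have hTι : ∀ a b, inner 𝕜 (T ((e ∘ ι) a)) (T ((e ∘ ι) b))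
      = if a = b then (((s ∘ ι) a ^ 2 : ℝ) : 𝕜) else 0 := fun a b => by
    simpa [hι.eq_iff] using hT (ι a) (ι b)
  refine le_iSup₂_of_le (e ∘ ι) (he.comp ι hι) ?_
  have hsι : ∀ i, 0 ≤ (s ∘ ι) i := fun i => hs _
  rw [gramDet_map_eq_prod hTι, Real.sqrt_sq (Finset.prod_nonneg fun i _ => hsι i),
    ENNReal.ofReal_prod_of_nonneg fun i _ => hsι i]
  refine Finset.prod_le_prod' fun j _ => ?_
  -- As `dim L j = j + 1`, some unit vector of `L j` is orthogonal to the `j` singular vectors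
  -- preceding the one indexed by `ι j`. It is stretched at least by `a j` and at most by `s (ι j)`.
  let φ : L j →ₗ[𝕜] (Fin j → 𝕜) := LinearMap.pi fun i =>
    (innerSL 𝕜 (e (ι (Fin.castLE j.2.le i))) : H →ₗ[𝕜] 𝕜) ∘ₗ (L j).subtype
  have hker : LinearMap.ker φ ≠ ⊥ := LinearMap.ker_ne_bot_of_finrank_lt (by simp [hrank])
  obtain ⟨y, hy, hy0⟩ := Submodule.exists_mem_ne_zero_of_ne_bot hker
  have hy' : (y : H) ≠ 0 := by simpa using hy0
  let ξ : H := ((‖(y : H)‖⁻¹ : ℝ) : 𝕜) • (y : H)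
  have hξ : ‖ξ‖ = 1 := by
    simp only [ξ, norm_smul, RCLike.norm_ofReal, abs_inv, abs_norm]
    exact inv_mul_cancel₀ (norm_ne_zero_iff.2 hy')
  have hξL : ξ ∈ L j := (L j).smul_mem _ y.2
  refine (hL j ξ hξL hξ).trans ?_
  obtain ⟨x, hx⟩ := (Submodule.mem_span_range_iff_exists_fun 𝕜).1
    (hspan.symm ▸ (le_iSup L j) hξL : ξ ∈ Submodule.span 𝕜 (Set.range e))
  have hx0 : ∀ i, i < ι j → x i = 0 := fun i hi => by
    have h1 : inner 𝕜 (e i) ξ = x i := by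
      rw [← hx, he.inner_right_fintype]
    have h2 : inner 𝕜 (e i) (y : H) = 0 :=
      congrFun (LinearMap.mem_ker.1 hy) ⟨i, Fin.lt_def.1 hi⟩
    rw [← h1, inner_smul_right, h2, mul_zero]
  rw [← ofReal_norm]
  refine ENNReal.ofReal_le_ofReal ((sq_le_sq₀ (norm_nonneg _) (hs _)).1 ?_)
  have h1 : ∑ i, ‖x i‖ ^ 2 = 1 := by rw [← he.norm_sq_sum_smul, hx, hξ, one_pow]
  rw [← hx, norm_sq_map_sum_smul hT]
  calc ∑ i, ‖x i‖ ^ 2 * s i ^ 2 ≤ ∑ i, ‖x i‖ ^ 2 * s (ι j) ^ 2 := by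
        refine Finset.sum_le_sum fun i _ => ?_
        rcases lt_or_ge i (ι j) with h | h
        · simp [hx0 i h]
        · gcongr
          · exact hs i
          · exact hanti h
    _ = _ := by rw [← Finset.sum_mul, h1, one_mul]

theorem prod_singularValue_eq_maxVolume [CompleteSpace H] (T : H →L[𝕜] H) (m : ℕ) :
    ∏ j ∈ Finset.Icc 1 m, singularValue T j = maxVolume m T := by
  rw [prod_Icc_eq_prod_fin]
  refine le_antisymm ?_ (maxVolume_le_prod_singularValue T)
  by_cases h0 : ∃ i : Fin m, singularValue T (i + 1) = 0
  · obtain ⟨i, hi⟩ := h0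
    rw [Finset.prod_eq_zero (Finset.mem_univ i) hi]
    exact zero_le
  push Not at h0
  have htop : ∀ i : Fin m, singularValue T (i + 1) ≠ ⊤ := fun i =>
    ((singularValue_le_enorm T i.succ_pos).trans_lt enorm_lt_top).ne
  -- Nonzero finite singular values strictly decrease when multiplied by `r < 1`; then `r → 1`.
  have hlt : ∀ r : ℝ≥0∞, r < 1 → r ^ m * ∏ i : Fin m, singularValue T (i + 1) ≤ maxVolume m T :=
    fun r hr => by
    have := prod_le_maxVolume T (a := fun i : Fin m => r * singularValue T (i + 1)) fun i => by
      simpa using (ENNReal.mul_lt_mul_iff_left (h0 i) (htop i)).2 hr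
    rwa [Finset.prod_mul_distrib, Finset.prod_const, Finset.card_univ, Fintype.card_fin] at this
  have hne : (𝓝[<] (1 : ℝ≥0∞)).NeBot := nhdsLT_neBot_of_exists_lt ⟨0, zero_lt_one⟩
  have hlim : Tendsto (fun r : ℝ≥0∞ => r ^ m * ∏ i : Fin m, singularValue T (i + 1)) (𝓝[<] 1)
      (𝓝 (1 ^ m * ∏ i : Fin m, singularValue T (i + 1))) :=
    ENNReal.Tendsto.mul_const
      (((ENNReal.continuous_pow m).tendsto 1).mono_left nhdsWithin_le_nhds)
      (Or.inl (by simp))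
  rw [one_pow, one_mul] at hlim
  exact le_of_tendsto hlim (eventually_nhdsWithin_of_forall hlt)

/-- This is `σ_{m+1} = V_{m+1} / V_m` written without division, so that vanishing volumes need no
separate treatment. -/
theorem omegaD_eq_maxVolume [CompleteSpace H] (T : H →L[𝕜] H) (m : ℕ) {γ : ℝ} (hγ₀ : 0 ≤ γ)
    (hγ₁ : γ ≤ 1) : omegaD m γ T = maxVolume m T ^ (1 - γ) * maxVolume (m + 1) T ^ γ := by
  rw [omegaD, ← prod_singularValue_eq_maxVolume, ← prod_singularValue_eq_maxVolume,
    Finset.prod_Icc_succ_top (Nat.le_add_left 1 m), ENNReal.mul_rpow_of_nonneg _ _ hγ₀, ← mul_assoc,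
    ← ENNReal.rpow_add_of_nonneg _ _ (sub_nonneg.2 hγ₁) hγ₀, sub_add_cancel, ENNReal.rpow_one]

theorem omegaD_comp_le [CompleteSpace H] (S T : H →L[𝕜] H) (m : ℕ) {γ : ℝ} (hγ₀ : 0 ≤ γ)
    (hγ₁ : γ ≤ 1) : omegaD m γ (S.comp T) ≤ omegaD m γ S * omegaD m γ T := by
  have hγ' := sub_nonneg.2 hγ₁
  simp only [omegaD_eq_maxVolume _ m hγ₀ hγ₁]
  rw [mul_mul_mul_comm, ← ENNReal.mul_rpow_of_nonneg _ _ hγ', ← ENNReal.mul_rpow_of_nonneg _ _ hγ₀]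
  gcongr <;> exact maxVolume_comp_le S T

theorem omegaD_le_enorm (T : H →L[𝕜] H) (m : ℕ) {γ : ℝ} (hγ₀ : 0 ≤ γ) :
    omegaD m γ T ≤ ‖T‖ₑ ^ m * ‖T‖ₑ ^ γ := by
  rw [omegaD, prod_Icc_eq_prod_fin]
  gcongr
  · refine (Finset.prod_le_prod' fun i _ => singularValue_le_enorm T i.succ_pos).trans ?_
    simp
  · exact singularValue_le_enorm T m.succ_pos

end SingularValues

/-! ### Absolute continuity of Gram determinants -/

section AbsolutelyContinuous

open AbsolutelyContinuousOnInterval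

theorem LipschitzOnWith.comp_absolutelyContinuousOnInterval {X Y : Type*} [PseudoMetricSpace X]
    [PseudoMetricSpace Y] {f : ℝ → X} {φ : X → Y} {K : ℝ≥0} {s : Set X} {a b : ℝ}
    (hφ : LipschitzOnWith K φ s) (hf : AbsolutelyContinuousOnInterval f a b)
    (hs : ∀ x ∈ Set.uIcc a b, f x ∈ s) :
    AbsolutelyContinuousOnInterval (fun x => φ (f x)) a b := by
  unfold AbsolutelyContinuousOnInterval at hf ⊢
  refine squeeze_zero' (.of_forall fun _ => Finset.sum_nonneg fun _ _ => dist_nonneg) ?_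
    (by simpa using hf.const_mul (K : ℝ))
  rw [eventually_inf_principal]
  filter_upwards with E hE
  rw [Finset.mul_sum]
  exact Finset.sum_le_sum fun i hi =>
    hφ.dist_le_mul _ (hs _ (hE.1 i hi).1) _ (hs _ (hE.1 i hi).2)

theorem absolutelyContinuousOnInterval_const {X : Type*} [PseudoMetricSpace X] (x : X) (a b : ℝ) :
    AbsolutelyContinuousOnInterval (fun _ => x) a b :=
  (LipschitzWith.const x).lipschitzOnWith.absolutelyContinuousOnInterval

theorem AbsolutelyContinuousOnInterval.finset_sum {ι F : Type*} [SeminormedAddCommGroup F]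
    {f : ι → ℝ → F} {a b : ℝ} (s : Finset ι)
    (hf : ∀ i ∈ s, AbsolutelyContinuousOnInterval (f i) a b) :
    AbsolutelyContinuousOnInterval (fun x => ∑ i ∈ s, f i x) a b := by
  classical
  induction s using Finset.induction_on with
  | empty => simpa using absolutelyContinuousOnInterval_const (0 : F) a b
  | insert i s hi ih =>
    simp only [Finset.sum_insert hi]
    exact (hf i (s.mem_insert_self i)).add (ih fun j hj => hf j (Finset.mem_insert_of_mem hj))

theorem AbsolutelyContinuousOnInterval.finset_prod {ι 𝕜 : Type*} [NormedField 𝕜]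
    {f : ι → ℝ → 𝕜} {a b : ℝ} (s : Finset ι)
    (hf : ∀ i ∈ s, AbsolutelyContinuousOnInterval (f i) a b) :
    AbsolutelyContinuousOnInterval (fun x => ∏ i ∈ s, f i x) a b := by
  classical
  induction s using Finset.induction_on with
  | empty => simpa using absolutelyContinuousOnInterval_const (1 : 𝕜) a b
  | insert i s hi ih =>
    simp only [Finset.prod_insert hi]
    exact (hf i (s.mem_insert_self i)).smul (ih fun j hj => hf j (Finset.mem_insert_of_mem hj))

/-- By compactness the values lie in some `[c, C]` with `c > 0`, where the logarithm is Lipschitz.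
-/
theorem AbsolutelyContinuousOnInterval.log {f : ℝ → ℝ} {a b : ℝ}
    (hf : AbsolutelyContinuousOnInterval f a b) (hpos : ∀ x ∈ Set.uIcc a b, 0 < f x) :
    AbsolutelyContinuousOnInterval (fun x => Real.log (f x)) a b := by
  have himg : IsCompact (f '' Set.uIcc a b) := isCompact_uIcc.image_of_continuousOn hf.continuousOn
  have hne : (f '' Set.uIcc a b).Nonempty := Set.nonempty_uIcc.image f
  obtain ⟨c, hc⟩ := himg.exists_isLeast hne
  obtain ⟨C, hC⟩ := himg.exists_isGreatest hne
  have hc0 : 0 < c := by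
    obtain ⟨x, hx, rfl⟩ := hc.1
    exact hpos x hx
  have hlog : ContDiffOn ℝ 1 Real.log (Set.Icc c C) :=
    Real.contDiffOn_log.mono fun x hx => (hc0.trans_le hx.1).ne'
  obtain ⟨K, hK⟩ := hlog.exists_lipschitzOnWith (by decide) (convex_Icc _ _) isCompact_Icc
  exact hK.comp_absolutelyContinuousOnInterval hf fun x hx =>
    ⟨hc.2 (Set.mem_image_of_mem f hx), hC.2 (Set.mem_image_of_mem f hx)⟩

variable {𝕜 V : Type*} [RCLike 𝕜] [AddCommGroup V] [Module 𝕜 V] {k : ℕ}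

theorem coreNorm_sq (c : InnerProductSpace.Core 𝕜 V) (x : V) :
    coreNorm c x ^ 2 = RCLike.re (c.inner x x) :=
  Real.sq_sqrt (c.re_inner_nonneg x)

theorem core_inner_eq_sum_coreNorm_sq (c : InnerProductSpace.Core 𝕜 V) (x y : V) :
    c.inner x y = ((coreNorm c (x + y) : 𝕜) ^ 2 - (coreNorm c (x - y) : 𝕜) ^ 2 +
      ((coreNorm c (x - (RCLike.I : 𝕜) • y) : 𝕜) ^ 2 -
        (coreNorm c (x + (RCLike.I : 𝕜) • y) : 𝕜) ^ 2) * RCLike.I) / 4 := by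
  let _ : NormedAddCommGroup V := c.toNormedAddCommGroup
  let _ : InnerProductSpace 𝕜 V := InnerProductSpace.ofCore c.toCore
  exact inner_eq_sum_norm_sq_div_four x y

/-- Polarization: `N` is a subspace, so the hypothesis on norms covers the sums and differences
involved. In the real case `I = 0` and the second difference vanishes. -/
theorem absolutelyContinuousOnInterval_core_inner {c : ℝ → InnerProductSpace.Core 𝕜 V}
    {S : ℝ → V →ₗ[𝕜] V} {N : Submodule 𝕜 V} {a b : ℝ}
    (h : ∀ ξ ∈ N, AbsolutelyContinuousOnInterval (fun s => coreNorm (c s) (S s ξ)) a b)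
    {ξ η : V} (hξ : ξ ∈ N) (hη : η ∈ N) :
    AbsolutelyContinuousOnInterval (fun s => (c s).inner (S s ξ) (S s η)) a b := by
  have hsq : ∀ ζ ∈ N,
      AbsolutelyContinuousOnInterval (fun s => ((coreNorm (c s) (S s ζ) : ℝ) : 𝕜) ^ 2) a b := by
    intro ζ hζ
    have h1 : AbsolutelyContinuousOnInterval (fun s => ((coreNorm (c s) (S s ζ) : ℝ) : 𝕜)) a b :=
      ((RCLike.ofRealCLM (K := 𝕜)).lipschitz.lipschitzOnWith (s := Set.univ)
        ).comp_absolutelyContinuousOnInterval (h ζ hζ) fun _ _ => trivial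
    simp only [pow_two]
    exact h1.smul h1
  have hIη := N.smul_mem (RCLike.I : 𝕜) hη
  have key := (((hsq _ (N.add_mem hξ hη)).sub (hsq _ (N.sub_mem hξ hη))).add
    (((hsq _ (N.sub_mem hξ hIη)).sub (hsq _ (N.add_mem hξ hIη))).const_smul
      (RCLike.I : 𝕜))).const_smul ((4 : 𝕜)⁻¹)
  convert! key using 2 with s
  rw [core_inner_eq_sum_coreNorm_sq]
  simp only [map_add, map_sub, map_smul, Pi.add_apply, Pi.sub_apply, smul_eq_mul]
  ring

theorem absolutelyContinuousOnInterval_gramDet {c : ℝ → InnerProductSpace.Core 𝕜 V}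
    {S : ℝ → V →ₗ[𝕜] V} {N : Submodule 𝕜 V} {a b : ℝ}
    (h : ∀ ξ ∈ N, AbsolutelyContinuousOnInterval (fun s => coreNorm (c s) (S s ξ)) a b)
    {v : Fin k → V} (hv : ∀ i, v i ∈ N) :
    AbsolutelyContinuousOnInterval (fun s => gramDet (c s) fun i => S s (v i)) a b := by
  have hdet : AbsolutelyContinuousOnInterval (fun s =>
      (Matrix.of fun i j => (c s).inner (S s (v i)) (S s (v j))).det) a b := by
    simp only [Matrix.det_apply', Matrix.of_apply]
    refine AbsolutelyContinuousOnInterval.finset_sum _ fun σ _ => ?_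
    refine AbsolutelyContinuousOnInterval.const_smul (((Equiv.Perm.sign σ : ℤ) : 𝕜)) ?_
    exact AbsolutelyContinuousOnInterval.finset_prod _ fun i _ =>
      absolutelyContinuousOnInterval_core_inner h (hv _) (hv _)
  exact ((RCLike.reCLM (K := 𝕜)).lipschitz.lipschitzOnWith (s := Set.univ)
    ).comp_absolutelyContinuousOnInterval hdet fun _ _ => trivial

end AbsolutelyContinuous

/-! ### Growth of volumes along the cocycle -/

section VolumeGrowth

variable {𝕜 H Q : Type*} [RCLike 𝕜] [NormedAddCommGroup H] [InnerProductSpace 𝕜 H]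
  [TopologicalSpace Q] {ϑ : Flow ℝ≥0 Q} {Ξ : ℝ≥0 → Q → H →L[𝕜] H}
  {n : Q → InnerProductSpace.Core 𝕜 H} {N : Q → Submodule 𝕜 H} {A : Q → H →ₗ.[𝕜] H} {k : ℕ}

theorem tendsto_toNNReal_nhdsGT_zero : Tendsto Real.toNNReal (𝓝[>] 0) (𝓝[>] 0) := by
  refine tendsto_nhdsWithin_iff.2 ⟨?_, ?_⟩
  · have := (continuous_real_toNNReal.tendsto 0).mono_left
      (nhdsWithin_le_nhds (a := (0 : ℝ)) (s := Set.Ioi 0))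
    rwa [Real.toNNReal_zero] at this
  · exact eventually_nhdsWithin_of_forall fun x hx => Real.toNNReal_pos.2 hx

/-- The right derivative of the squared norm along the cocycle. -/
theorem hasDerivWithinAt_inner_self (hΞ : IsUniformlyContinuousCocycle ϑ Ξ)
    (hA : IsMeanRepresentation ϑ Ξ n N A) (q : Q) (ξ : (A q).domain) (hξ : (ξ : H) ∈ N q) :
    HasDerivWithinAt (fun h : ℝ => RCLike.re ((n (ϑ h.toNNReal q)).inner
      (Ξ h.toNNReal q (ξ : H)) (Ξ h.toNNReal q (ξ : H))))
      (2 * RCLike.re ((n q).inner (ξ : H) (A q ξ))) (Set.Ioi 0) 0 := by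
  rw [hasDerivWithinAt_iff_tendsto_slope' (Set.notMem_Ioi.2 le_rfl)]
  -- The factor `2` cancels the `1 / 2` of the curvature form.
  have h := (((RCLike.continuous_re.tendsto _).comp ((hA q).2 ξ hξ)).comp
    tendsto_toNNReal_nhdsGT_zero).const_mul 2
  rw [RCLike.ofReal_re] at h
  refine h.congr' (eventually_nhdsWithin_of_forall fun t ht => ?_)
  have ht' : ((t.toNNReal : ℝ≥0) : ℝ) = t := Real.coe_toNNReal t (le_of_lt ht)
  have hz : ϑ (0 : ℝ).toNNReal q = q := by rw [Real.toNNReal_zero, Flow.map_zero_apply]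
  simp only [Function.comp, ht', slope_def_field, sub_zero]
  rw [hz, Real.toNNReal_zero, hΞ.map_zero, ContinuousLinearMap.id_apply]
  rw [show (1 / 2 : 𝕜) = ((1 / 2 : ℝ) : 𝕜) by push_cast; rfl, RCLike.re_ofReal_mul,
    RCLike.div_re_ofReal, map_sub]
  ring

/-- The logarithmic derivative of a Gram determinant along the cocycle at time `0` is bounded
by a trace sum. -/
theorem half_deriv_log_gramDet_le_at_zero (hΞ : IsUniformlyContinuousCocycle ϑ Ξ)
    (hA : IsMeanRepresentation ϑ Ξ n N A) (q : Q) {v : Fin k → H} (hv : ∀ i, v i ∈ N q)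
    (hli : LinearIndependent 𝕜 v) {D : ℝ}
    (hpos : ∀ᶠ h : ℝ in 𝓝[>] 0,
      0 < gramDet (n (ϑ h.toNNReal q)) fun i => Ξ h.toNNReal q (v i))
    (hD : HasDerivWithinAt (fun h : ℝ =>
      Real.log (gramDet (n (ϑ h.toNNReal q)) fun i => Ξ h.toNNReal q (v i))) D (Set.Ioi 0) 0) :
    ((D / 2 : ℝ) : EReal) ≤ traceSum (n q) (A q) k := by
  obtain ⟨e, P, he, hspan, hve⟩ := exists_coreOrthonormal_of_linearIndependent (n q) hli
  have heN : ∀ i, e i ∈ N q := fun i =>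
    (Submodule.span_le.2 (Set.range_subset_iff.2 hv) : _ ≤ N q)
      (hspan ▸ Submodule.subset_span (Set.mem_range_self i))
  let e' : Fin k → (A q).domain := fun i => ⟨e i, (hA q).1 (heN i)⟩
  refine le_trans (EReal.coe_le_coe_iff.2 ?_) (sum_re_inner_le_traceSum (n q) (A q) (e := e') he)
  set R : ℝ := ∑ i, RCLike.re ((n q).inner (e' i : H) (A q (e' i))) with hR
  -- `M ^ k` dominates the Gram determinant of the images of `e` and equals it at time `0`. It
  -- involves only squared norms, whose right derivatives are known.
  let M : ℝ → ℝ := fun h => (∑ i, RCLike.re ((n (ϑ h.toNNReal q)).inner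
      (Ξ h.toNNReal q (e' i : H)) (Ξ h.toNNReal q (e' i : H)))) / k
  have hM : HasDerivWithinAt M ((∑ i, 2 * RCLike.re ((n q).inner (e' i : H) (A q (e' i)))) / k)
      (Set.Ioi 0) 0 :=
    (HasDerivWithinAt.fun_sum fun i _ =>
      hasDerivWithinAt_inner_self hΞ hA q (e' i) (heN i)).div_const _
  have hMk := hM.fun_pow k
  have hn0 : ∀ i j : Fin k, (n q).inner (e i) (e j) = if i = j then 1 else 0 := he
  have hM0 : 0 < k → M 0 = 1 := fun hk => by
    have hk' : (k : ℝ) ≠ 0 := (Nat.cast_pos.2 hk).ne'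
    have hz : ϑ (0 : ℝ).toNNReal q = q := by rw [Real.toNNReal_zero, Flow.map_zero_apply]
    simp only [M, e']
    rw [hz, Real.toNNReal_zero, hΞ.map_zero]
    simp only [ContinuousLinearMap.id_apply, hn0, if_true, RCLike.one_re, Finset.sum_const,
      Finset.card_univ, Fintype.card_fin, nsmul_eq_mul, mul_one]
    exact div_self hk'
  have hM0k : M 0 ^ k = 1 := by
    rcases Nat.eq_zero_or_pos k with rfl | hk
    · simp
    · rw [hM0 hk, one_pow]
  have hderiv : (k : ℝ) * M 0 ^ (k - 1) *
      ((∑ i, 2 * RCLike.re ((n q).inner (e' i : H) (A q (e' i)))) / k) = 2 * R := by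
    rw [← Finset.mul_sum, ← hR]
    rcases Nat.eq_zero_or_pos k with rfl | hk
    · simp [hR]
    · have hk' : (k : ℝ) ≠ 0 := (Nat.cast_pos.2 hk).ne'
      rw [hM0 hk, one_pow]
      field_simp
  rw [hderiv] at hMk
  have hP : ‖P.det‖ ^ 2 = gramDet (n q) v := by
    rw [hve, gramDet_sum_smul, he.gramDet_eq_one, mul_one]
  have hPpos : 0 < ‖P.det‖ ^ 2 := hP ▸ (gramDet_pos_iff (n q) v).2 hli
  rw [hasDerivWithinAt_iff_tendsto_slope' (Set.notMem_Ioi.2 le_rfl)] at hD hMk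
  have hle : D ≤ 2 * R := by
    refine le_of_tendsto_of_tendsto hD hMk ?_
    filter_upwards [hpos, self_mem_nhdsWithin] with h hh hh0
    have hh0' : (0 : ℝ) < h := hh0
    have hfac : (gramDet (n (ϑ h.toNNReal q)) fun i => Ξ h.toNNReal q (v i))
        = ‖P.det‖ ^ 2 * gramDet (n (ϑ h.toNNReal q)) fun i => Ξ h.toNNReal q (e i) := by
      have := gramDet_map_sum_smul (n (ϑ h.toNNReal q)) (Ξ h.toNNReal q : H →ₗ[𝕜] H) P e
      simp only [ContinuousLinearMap.coe_coe] at this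
      rw [← this, hve]
    have hgpos : 0 < gramDet (n (ϑ h.toNNReal q)) fun i => Ξ h.toNNReal q (e i) :=
      pos_of_mul_pos_right (hfac ▸ hh) hPpos.le
    have hg : (gramDet (n (ϑ h.toNNReal q)) fun i => Ξ h.toNNReal q (e i)) ≤ M h ^ k :=
      gramDet_le_mean_pow _ _
    have hz : (gramDet (n (ϑ (0 : ℝ).toNNReal q)) fun i => Ξ (0 : ℝ).toNNReal q (v i))
        = ‖P.det‖ ^ 2 := by
      simp [hΞ.map_zero, Flow.map_zero_apply, hP]
    simp only [slope_def_field, sub_zero]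
    -- The constant `‖P.det‖ ^ 2` drops out of the difference quotient, and `log x ≤ x - 1` compares
    -- the rest with the quotient of `M ^ k`.
    rw [hM0k, hz, hfac, Real.log_mul hPpos.ne' hgpos.ne', add_sub_cancel_left]
    gcongr
    linarith [Real.log_le_sub_one_of_pos hgpos]
  linarith

theorem linearIndependent_cocycle_of_add (hΞ : IsUniformlyContinuousCocycle ϑ Ξ) {q : Q}
    {v : Fin k → H} {s r : ℝ≥0} (h : LinearIndependent 𝕜 fun i => Ξ (r + s) q (v i)) :
    LinearIndependent 𝕜 fun i => Ξ s q (v i) := by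
  refine LinearIndependent.of_comp (Ξ r (ϑ s q) : H →ₗ[𝕜] H) ?_
  convert! h using 1
  funext i
  simp [hΞ.map_add]

/-- The images at time `t` are images of those at time `s`, so dependence persists. Nondegeneracy at
the final time thus makes the logarithm meaningful on all of `[0, t]`. -/
theorem gramDet_cocycle_pos (hΞ : IsUniformlyContinuousCocycle ϑ Ξ) {q : Q} {v : Fin k → H}
    {t : ℝ} (hpos : 0 < gramDet (n (ϑ t.toNNReal q)) fun i => Ξ t.toNNReal q (v i)) {s : ℝ}
    (hs : s ≤ t) : 0 < gramDet (n (ϑ s.toNNReal q)) fun i => Ξ s.toNNReal q (v i) := by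
  rw [gramDet_pos_iff] at hpos ⊢
  refine linearIndependent_cocycle_of_add hΞ (r := t.toNNReal - s.toNNReal) ?_
  rwa [tsub_add_cancel_of_le (Real.toNNReal_le_toNNReal hs)]

/-- The cocycle property moves time `s` over `q` to time `0` over `ϑ s q`. Strictness of `s < t`
leaves room for a right neighbourhood with positive Gram determinants. -/
theorem half_deriv_log_gramDet_le (hΞ : IsUniformlyContinuousCocycle ϑ Ξ)
    (hN : AdmitsGrowthExponents ϑ Ξ (fun q => coreNorm (n q)) N)
    (hA : IsMeanRepresentation ϑ Ξ n N A) (q : Q) {v : Fin k → H} (hv : ∀ i, v i ∈ N q)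
    {s t : ℝ} (hs : 0 ≤ s) (hst : s < t)
    (hpos : 0 < gramDet (n (ϑ t.toNNReal q)) fun i => Ξ t.toNNReal q (v i))
    (hd : DifferentiableAt ℝ (fun u : ℝ =>
      Real.log (gramDet (n (ϑ u.toNNReal q)) fun i => Ξ u.toNNReal q (v i))) s) :
    ((deriv (fun u : ℝ => Real.log (gramDet (n (ϑ u.toNNReal q))
        fun i => Ξ u.toNNReal q (v i))) s / 2 : ℝ) : EReal) ≤
      traceSum (n (ϑ s.toNNReal q)) (A (ϑ s.toNNReal q)) k := by
  have hshift : ∀ h : ℝ, 0 ≤ h →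
      (gramDet (n (ϑ (s + h).toNNReal q)) fun i => Ξ (s + h).toNNReal q (v i))
        = gramDet (n (ϑ h.toNNReal (ϑ s.toNNReal q)))
          fun i => Ξ h.toNNReal (ϑ s.toNNReal q) (Ξ s.toNNReal q (v i)) := fun h hh => by
    rw [Real.toNNReal_add hs hh, add_comm, Flow.map_add]
    simp [hΞ.map_add]
  have hli : LinearIndependent 𝕜 fun i => Ξ s.toNNReal q (v i) :=
    (gramDet_pos_iff _ _).1 (gramDet_cocycle_pos hΞ hpos hst.le)
  refine half_deriv_log_gramDet_le_at_zero hΞ hA (ϑ s.toNNReal q)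
    (v := fun i => Ξ s.toNNReal q (v i)) (fun i => hN.invariant _ _ _ (hv i)) hli ?_ ?_
  · have : Set.Ioo 0 (t - s) ∈ 𝓝[>] (0 : ℝ) := Ioo_mem_nhdsGT (sub_pos.2 hst)
    filter_upwards [this] with h hh
    rw [← hshift h hh.1.le]
    exact gramDet_cocycle_pos hΞ hpos (by linarith [hh.2])
  · have h1 := hd.hasDerivAt
    rw [← add_zero s] at h1
    have h2 := (h1.comp_const_add s 0).hasDerivWithinAt (s := Set.Ioi 0)
    simp only [add_zero] at h2
    refine h2.congr (fun h hh => ?_) ?_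
    · rw [hshift h (le_of_lt hh)]
    · rw [hshift 0 le_rfl]

theorem absolutelyContinuousOnInterval_log_gramDet (hΞ : IsUniformlyContinuousCocycle ϑ Ξ)
    (hN : AdmitsGrowthExponents ϑ Ξ (fun q => coreNorm (n q)) N) (q : Q) {v : Fin k → H}
    (hv : ∀ i, v i ∈ N q) {t : ℝ} (ht : 0 < t)
    (hpos : 0 < gramDet (n (ϑ t.toNNReal q)) fun i => Ξ t.toNNReal q (v i)) :
    AbsolutelyContinuousOnInterval (fun u : ℝ =>
      Real.log (gramDet (n (ϑ u.toNNReal q)) fun i => Ξ u.toNNReal q (v i))) 0 t := by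
  refine AbsolutelyContinuousOnInterval.log ?_ fun x hx => ?_
  · exact absolutelyContinuousOnInterval_gramDet (c := fun u : ℝ => n (ϑ u.toNNReal q))
      (S := fun u : ℝ => (Ξ u.toNNReal q : H →ₗ[𝕜] H)) (fun ξ hξ =>
        hN.absolutelyContinuous q ξ hξ t ht) hv
  · rw [Set.uIcc_of_le ht.le] at hx
    exact gramDet_cocycle_pos hΞ hpos hx.2

end VolumeGrowth

/-! ### The estimate of the function of singular values at a given time -/

section VolumeEstimate

theorem sqrt_gramDet_le_of_coreNorm_le {𝕜 V : Type*} [RCLike 𝕜] [AddCommGroup V] [Module 𝕜 V]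
    {k : ℕ} {c c' : InnerProductSpace.Core 𝕜 V} {M : ℝ} (hM : 0 ≤ M)
    (h : ∀ x, coreNorm c' x ≤ M * coreNorm c x) (v : Fin k → V) :
    √(gramDet c' v) ≤ M ^ k * √(gramDet c v) := by
  refine Real.sqrt_le_iff.2 ⟨by positivity, ?_⟩
  rw [mul_pow, Real.sq_sqrt (gramDet_nonneg c v), ← pow_mul, mul_comm k 2, pow_mul]
  refine gramDet_le_of_core_le (fun x => ?_) v
  rw [← coreNorm_sq, ← coreNorm_sq, ← mul_pow]
  exact pow_le_pow_left₀ (Real.sqrt_nonneg _) (h x) 2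

theorem continuous_gramDet {𝕜 H : Type*} [RCLike 𝕜] [NormedAddCommGroup H]
    [InnerProductSpace 𝕜 H] {k : ℕ} :
    Continuous fun v : Fin k → H => gramDet (InnerProductSpace.toCore (𝕜 := 𝕜)) v := by
  refine RCLike.continuous_re.comp (Continuous.matrix_det (continuous_matrix fun i j => ?_))
  change Continuous fun v : Fin k → H => inner 𝕜 (v i) (v j)
  fun_prop

theorem iSup_rpow_mul_le {ι : Type*} {s : ι → Prop} {f : ι → ℝ≥0∞} {p : ℝ} (hp : 0 < p)
    {c C : ℝ≥0∞} (h : ∀ i, s i → f i ^ p * c ≤ C) : (⨆ (i) (_ : s i), f i) ^ p * c ≤ C := by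
  have : (⨆ (i) (_ : s i), f i) ^ p = ⨆ (i) (_ : s i), f i ^ p :=
    (ENNReal.orderIsoRpow p hp).map_iSup₂ _
  rw [this]
  simp only [ENNReal.iSup_mul]
  exact iSup₂_le h

theorem toCore_coreNorm {𝕜 H : Type*} [RCLike 𝕜] [NormedAddCommGroup H]
    [InnerProductSpace 𝕜 H] (x : H) : coreNorm (InnerProductSpace.toCore (𝕜 := 𝕜)) x = ‖x‖ :=
  (norm_eq_sqrt_re_inner (𝕜 := 𝕜) x).symm

variable {𝕜 H Q : Type*} [RCLike 𝕜] [NormedAddCommGroup H] [InnerProductSpace 𝕜 H]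
  [TopologicalSpace Q] {ϑ : Flow ℝ≥0 Q} {Ξ : ℝ≥0 → Q → H →L[𝕜] H}
  {n : Q → InnerProductSpace.Core 𝕜 H} {N : Q → Submodule 𝕜 H} {A : Q → H →ₗ.[𝕜] H}
  {k₁ k₂ : ℕ}

/-- `p₁ * τ₁ + p₂ * τ₂ ≤ M`, where `τ₁` and `τ₂` are the trace sums of orders `k₁` and `k₂` of `A`,
provided that the domain of `A` has subspaces of both dimensions. -/
def WeightedTraceSumLE {V : Type*} [AddCommGroup V] [Module 𝕜 V] (c : InnerProductSpace.Core 𝕜 V)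
    (A : V →ₗ.[𝕜] V) (k₁ k₂ : ℕ) (p₁ p₂ M : ℝ) : Prop :=
  ∀ (v₁ : Fin k₁ → V) (v₂ : Fin k₂ → V), LinearIndependent 𝕜 v₁ → LinearIndependent 𝕜 v₂ →
    (∀ i, v₁ i ∈ A.domain) → (∀ i, v₂ i ∈ A.domain) → ∀ x y : ℝ,
    (x : EReal) ≤ traceSum c A k₁ → (y : EReal) ≤ traceSum c A k₂ → p₁ * x + p₂ * y ≤ M

/-- The fundamental theorem of calculus for absolutely continuous functions, applied to both
logarithms at once since `g` bounds only the weighted sum. The factor `2` appears because Gram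
determinants are squared volumes. -/
theorem weighted_log_gramDet_le (hΞ : IsUniformlyContinuousCocycle ϑ Ξ)
    (hN : AdmitsGrowthExponents ϑ Ξ (fun q => coreNorm (n q)) N)
    (hA : IsMeanRepresentation ϑ Ξ n N A) (q : Q) {v : Fin k₁ → H} (hv : ∀ i, v i ∈ N q)
    {w : Fin k₂ → H} (hw : ∀ i, w i ∈ N q) {p₁ p₂ t : ℝ} (ht : 0 < t)
    (hvpos : 0 < gramDet (n (ϑ t.toNNReal q)) fun i => Ξ t.toNNReal q (v i))
    (hwpos : 0 < gramDet (n (ϑ t.toNNReal q)) fun i => Ξ t.toNNReal q (w i))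
    {g : ℝ → ℝ} (hg : IntervalIntegrable g volume 0 t)
    (hle : ∀ᵐ s : ℝ, s ∈ Set.Ioo 0 t →
      WeightedTraceSumLE (n (ϑ s.toNNReal q)) (A (ϑ s.toNNReal q)) k₁ k₂ p₁ p₂ (g s)) :
    p₁ * (Real.log (gramDet (n (ϑ t.toNNReal q)) fun i => Ξ t.toNNReal q (v i)) -
        Real.log (gramDet (n q) v)) +
      p₂ * (Real.log (gramDet (n (ϑ t.toNNReal q)) fun i => Ξ t.toNNReal q (w i)) -
        Real.log (gramDet (n q) w)) ≤ 2 * ∫ s in (0 : ℝ)..t, g s := by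
  set f₁ : ℝ → ℝ := fun u =>
    Real.log (gramDet (n (ϑ u.toNNReal q)) fun i => Ξ u.toNNReal q (v i)) with hf₁
  set f₂ : ℝ → ℝ := fun u =>
    Real.log (gramDet (n (ϑ u.toNNReal q)) fun i => Ξ u.toNNReal q (w i)) with hf₂
  have hac₁ : AbsolutelyContinuousOnInterval f₁ 0 t :=
    absolutelyContinuousOnInterval_log_gramDet hΞ hN q hv ht hvpos
  have hac₂ : AbsolutelyContinuousOnInterval f₂ 0 t :=
    absolutelyContinuousOnInterval_log_gramDet hΞ hN q hw ht hwpos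
  have h01 : f₁ 0 = Real.log (gramDet (n q) v) := by
    simp [hf₁, hΞ.map_zero, Flow.map_zero_apply]
  have h02 : f₂ 0 = Real.log (gramDet (n q) w) := by
    simp [hf₂, hΞ.map_zero, Flow.map_zero_apply]
  have hd₁ := hac₁.intervalIntegrable_deriv.const_mul p₁
  have hd₂ := hac₂.intervalIntegrable_deriv.const_mul p₂
  rw [← h01, ← h02, ← hac₁.integral_deriv_eq_sub, ← hac₂.integral_deriv_eq_sub,
    ← intervalIntegral.integral_const_mul, ← intervalIntegral.integral_const_mul,
    ← intervalIntegral.integral_const_mul, ← intervalIntegral.integral_add hd₁ hd₂]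
  refine intervalIntegral.integral_mono_ae_restrict ht.le (hd₁.add hd₂) (hg.const_mul 2) ?_
  have hset : (Set.Icc 0 t : Set ℝ) =ᵐ[volume] Set.Ioo 0 t := Ioo_ae_eq_Icc.symm
  change ∀ᵐ s ∂(volume.restrict (Set.Icc 0 t)), _
  rw [Measure.restrict_congr_set hset, ae_restrict_iff' measurableSet_Ioo]
  filter_upwards [hle, hac₁.ae_differentiableAt, hac₂.ae_differentiableAt] with s hs h1 h2 hst
  have hmem : s ∈ Set.uIcc 0 t := by
    rw [Set.uIcc_of_le ht.le]
    exact ⟨hst.1.le, hst.2.le⟩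
  have hdom : ∀ {k : ℕ} {u : Fin k → H}, (∀ i, u i ∈ N q) →
      ∀ i, Ξ s.toNNReal q (u i) ∈ (A (ϑ s.toNNReal q)).domain := fun hu i =>
    (hA _).1 (hN.invariant _ _ _ (hu i))
  have key := hs hst (fun i => Ξ s.toNNReal q (v i)) (fun i => Ξ s.toNNReal q (w i))
    ((gramDet_pos_iff _ _).1 (gramDet_cocycle_pos hΞ hvpos hst.2.le))
    ((gramDet_pos_iff _ _).1 (gramDet_cocycle_pos hΞ hwpos hst.2.le)) (hdom hv) (hdom hw) _ _
    (half_deriv_log_gramDet_le hΞ hN hA q hv hst.1.le hst.2 hvpos (h1 hmem))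
    (half_deriv_log_gramDet_le hΞ hN hA q hw hst.1.le hst.2 hwpos (h2 hmem))
  linarith

theorem weighted_volume_le (hΞ : IsUniformlyContinuousCocycle ϑ Ξ)
    (hN : AdmitsGrowthExponents ϑ Ξ (fun q => coreNorm (n q)) N)
    (hA : IsMeanRepresentation ϑ Ξ n N A) (q : Q) {v : Fin k₁ → H} (hv : ∀ i, v i ∈ N q)
    {w : Fin k₂ → H} (hw : ∀ i, w i ∈ N q) {p₁ p₂ t : ℝ} (hp₁ : 0 < p₁) (hp₂ : 0 < p₂)
    (ht : 0 < t) {g : ℝ → ℝ} (hg : IntervalIntegrable g volume 0 t)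
    (hle : ∀ᵐ s : ℝ, s ∈ Set.Ioo 0 t →
      WeightedTraceSumLE (n (ϑ s.toNNReal q)) (A (ϑ s.toNNReal q)) k₁ k₂ p₁ p₂ (g s)) :
    √(gramDet (n (ϑ t.toNNReal q)) fun i => Ξ t.toNNReal q (v i)) ^ p₁ *
      √(gramDet (n (ϑ t.toNNReal q)) fun i => Ξ t.toNNReal q (w i)) ^ p₂ ≤
    Real.exp (∫ s in (0 : ℝ)..t, g s) * (√(gramDet (n q) v) ^ p₁ * √(gramDet (n q) w) ^ p₂) := by
  -- If a volume degenerates by time `t`, the left side is zero because the weights are positive.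
  rcases (gramDet_nonneg (n (ϑ t.toNNReal q)) fun i => Ξ t.toNNReal q (v i)).eq_or_lt with h | hvpos
  · rw [← h, Real.sqrt_zero, Real.zero_rpow hp₁.ne', zero_mul]
    positivity
  rcases (gramDet_nonneg (n (ϑ t.toNNReal q)) fun i => Ξ t.toNNReal q (w i)).eq_or_lt with h | hwpos
  · rw [← h, Real.sqrt_zero, Real.zero_rpow hp₂.ne', mul_zero]
    positivity
  have hv0 : 0 < gramDet (n q) v := by
    have := gramDet_cocycle_pos hΞ hvpos ht.le
    simpa [hΞ.map_zero, Flow.map_zero_apply] using this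
  have hw0 : 0 < gramDet (n q) w := by
    have := gramDet_cocycle_pos hΞ hwpos ht.le
    simpa [hΞ.map_zero, Flow.map_zero_apply] using this
  have key := weighted_log_gramDet_le hΞ hN hA q hv hw ht hvpos hwpos hg hle
  rw [Real.rpow_def_of_pos (Real.sqrt_pos.2 hvpos), Real.rpow_def_of_pos (Real.sqrt_pos.2 hwpos),
    Real.rpow_def_of_pos (Real.sqrt_pos.2 hv0), Real.rpow_def_of_pos (Real.sqrt_pos.2 hw0),
    Real.log_sqrt hvpos.le, Real.log_sqrt hwpos.le, Real.log_sqrt hv0.le, Real.log_sqrt hw0.le,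
    ← Real.exp_add, ← Real.exp_add, ← Real.exp_add, Real.exp_le_exp]
  linarith

/-- The weighted product of the volumes of the images of two families under the cocycle, measured
in the norm of `H`. -/
theorem weighted_volume_le_of_mem (hΞ : IsUniformlyContinuousCocycle ϑ Ξ)
    (hN : AdmitsGrowthExponents ϑ Ξ (fun q => coreNorm (n q)) N)
    (hA : IsMeanRepresentation ϑ Ξ n N A) {a b : ℝ} (ha : 0 < a) (hb : 0 < b)
    (hab : ∀ q ξ, a * ‖ξ‖ ≤ coreNorm (n q) ξ ∧ coreNorm (n q) ξ ≤ b * ‖ξ‖)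
    (q : Q) {v : Fin k₁ → H} (hv : ∀ i, v i ∈ N q)
    {w : Fin k₂ → H} (hw : ∀ i, w i ∈ N q) {p₁ p₂ t : ℝ} (hp₁ : 0 < p₁) (hp₂ : 0 < p₂)
    (ht : 0 < t) {g : ℝ → ℝ} (hg : IntervalIntegrable g volume 0 t)
    (hle : ∀ᵐ s : ℝ, s ∈ Set.Ioo 0 t →
      WeightedTraceSumLE (n (ϑ s.toNNReal q)) (A (ϑ s.toNNReal q)) k₁ k₂ p₁ p₂ (g s)) :
    √(gramDet (InnerProductSpace.toCore (𝕜 := 𝕜)) fun i => Ξ t.toNNReal q (v i)) ^ p₁ *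
      √(gramDet (InnerProductSpace.toCore (𝕜 := 𝕜)) fun i => Ξ t.toNNReal q (w i)) ^ p₂ ≤
    (b / a) ^ (k₁ * p₁ + k₂ * p₂) * Real.exp (∫ s in (0 : ℝ)..t, g s) *
      (√(gramDet (InnerProductSpace.toCore (𝕜 := 𝕜)) v) ^ p₁ *
        √(gramDet (InnerProductSpace.toCore (𝕜 := 𝕜)) w) ^ p₂) := by
  have hlow : ∀ (q : Q) (k : ℕ) (u : Fin k → H),
      √(gramDet (InnerProductSpace.toCore (𝕜 := 𝕜)) u) ≤ a⁻¹ ^ k * √(gramDet (n q) u) :=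
    fun q k u => sqrt_gramDet_le_of_coreNorm_le (inv_pos.2 ha).le (fun x => by
      rw [toCore_coreNorm, inv_mul_eq_div, le_div_iff₀ ha, mul_comm]
      exact (hab q x).1) u
  have hup : ∀ (q : Q) (k : ℕ) (u : Fin k → H),
      √(gramDet (n q) u) ≤ b ^ k * √(gramDet (InnerProductSpace.toCore (𝕜 := 𝕜)) u) :=
    fun q k u => sqrt_gramDet_le_of_coreNorm_le hb.le (fun x => by
      rw [toCore_coreNorm]
      exact (hab q x).2) u
  have key := weighted_volume_le hΞ hN hA q hv hw hp₁ hp₂ ht hg hle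
  -- Each vector contributes `b` from the change of norm at time `0` and `a⁻¹` from that at time
  -- `t`.
  have hconst : (b / a) ^ (k₁ * p₁ + k₂ * p₂)
      = ((a⁻¹ ^ k₁) ^ p₁ * (a⁻¹ ^ k₂) ^ p₂) * ((b ^ k₁) ^ p₁ * (b ^ k₂) ^ p₂) := by
    have hpow : ∀ (x : ℝ) (k : ℕ) (p : ℝ), 0 < x → (x ^ k) ^ p = x ^ (k * p) :=
      fun x k p hx => by rw [← Real.rpow_natCast, ← Real.rpow_mul hx.le]
    have ha' := inv_pos.2 ha
    rw [hpow _ _ _ ha', hpow _ _ _ ha', hpow _ _ _ hb, hpow _ _ _ hb, ← Real.rpow_add ha',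
      ← Real.rpow_add hb, ← Real.mul_rpow ha'.le hb.le, inv_mul_eq_div]
  set X₁ := √(gramDet (n (ϑ t.toNNReal q)) fun i => Ξ t.toNNReal q (v i)) with hX₁
  set X₂ := √(gramDet (n (ϑ t.toNNReal q)) fun i => Ξ t.toNNReal q (w i)) with hX₂
  set Y₁ := √(gramDet (InnerProductSpace.toCore (𝕜 := 𝕜)) v) with hY₁
  set Y₂ := √(gramDet (InnerProductSpace.toCore (𝕜 := 𝕜)) w) with hY₂
  have hainv : 0 < a⁻¹ := inv_pos.2 ha
  calc _ ≤ (a⁻¹ ^ k₁ * X₁) ^ p₁ * (a⁻¹ ^ k₂ * X₂) ^ p₂ := by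
        gcongr
        · exact hlow _ _ _
        · exact hlow _ _ _
    _ = ((a⁻¹ ^ k₁) ^ p₁ * (a⁻¹ ^ k₂) ^ p₂) * (X₁ ^ p₁ * X₂ ^ p₂) := by
        rw [Real.mul_rpow (by positivity) (Real.sqrt_nonneg _),
          Real.mul_rpow (by positivity) (Real.sqrt_nonneg _)]
        ring
    _ ≤ ((a⁻¹ ^ k₁) ^ p₁ * (a⁻¹ ^ k₂) ^ p₂) * (Real.exp (∫ s in (0 : ℝ)..t, g s) *
          ((b ^ k₁ * Y₁) ^ p₁ * (b ^ k₂ * Y₂) ^ p₂)) := by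
        refine mul_le_mul_of_nonneg_left (key.trans ?_) (by positivity)
        gcongr
        · exact hup _ _ _
        · exact hup _ _ _
    _ = _ := by
        rw [hconst, Real.mul_rpow (by positivity) (Real.sqrt_nonneg _),
          Real.mul_rpow (by positivity) (Real.sqrt_nonneg _)]
        ring

/-- Orthonormal families need not lie in `N q`. The inequality for arbitrary families is closed
under limits, so it passes from the dense `N q` to all of `H` and is then specialized. -/
theorem maxVolume_rpow_mul_le (hΞ : IsUniformlyContinuousCocycle ϑ Ξ)
    (hN : AdmitsGrowthExponents ϑ Ξ (fun q => coreNorm (n q)) N)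
    (hA : IsMeanRepresentation ϑ Ξ n N A) {a b : ℝ} (ha : 0 < a) (hb : 0 < b)
    (hab : ∀ q ξ, a * ‖ξ‖ ≤ coreNorm (n q) ξ ∧ coreNorm (n q) ξ ≤ b * ‖ξ‖)
    (q : Q) {p₁ p₂ t : ℝ} (hp₁ : 0 < p₁) (hp₂ : 0 < p₂)
    (ht : 0 < t) {g : ℝ → ℝ} (hg : IntervalIntegrable g volume 0 t)
    (hle : ∀ᵐ s : ℝ, s ∈ Set.Ioo 0 t →
      WeightedTraceSumLE (n (ϑ s.toNNReal q)) (A (ϑ s.toNNReal q)) k₁ k₂ p₁ p₂ (g s)) :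
    maxVolume k₁ (Ξ t.toNNReal q) ^ p₁ * maxVolume k₂ (Ξ t.toNNReal q) ^ p₂ ≤
      ENNReal.ofReal ((b / a) ^ (k₁ * p₁ + k₂ * p₂) * Real.exp (∫ s in (0 : ℝ)..t, g s)) := by
  have hall : ∀ x : (Fin k₁ → H) × (Fin k₂ → H),
      √(gramDet (InnerProductSpace.toCore (𝕜 := 𝕜)) fun i => Ξ t.toNNReal q (x.1 i)) ^ p₁ *
        √(gramDet (InnerProductSpace.toCore (𝕜 := 𝕜)) fun i => Ξ t.toNNReal q (x.2 i)) ^ p₂ ≤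
      (b / a) ^ (k₁ * p₁ + k₂ * p₂) * Real.exp (∫ s in (0 : ℝ)..t, g s) *
        (√(gramDet (InnerProductSpace.toCore (𝕜 := 𝕜)) x.1) ^ p₁ *
          √(gramDet (InnerProductSpace.toCore (𝕜 := 𝕜)) x.2) ^ p₂) := by
    have hdense : Dense ((Set.univ.pi fun _ : Fin k₁ => (N q : Set H)) ×ˢ
        (Set.univ.pi fun _ : Fin k₂ => (N q : Set H))) :=
      (dense_pi _ fun _ _ => hN.dense q).prod (dense_pi _ fun _ _ => hN.dense q)
    have hvol : ∀ (k : ℕ) (p : ℝ), 0 < p → Continuous fun u : Fin k → H =>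
        √(gramDet (InnerProductSpace.toCore (𝕜 := 𝕜)) u) ^ p := fun k p hp =>
      (continuous_gramDet.sqrt).rpow_const fun _ => Or.inr hp.le
    have hmap : ∀ k : ℕ, Continuous fun u : Fin k → H => fun i => Ξ t.toNNReal q (u i) :=
      fun k => by fun_prop
    refine isClosed_property hdense.denseRange_val (isClosed_le ?_ ?_) ?_
    · exact (((hvol k₁ p₁ hp₁).comp (hmap k₁)).comp continuous_fst).mul
        (((hvol k₂ p₂ hp₂).comp (hmap k₂)).comp continuous_snd)
    · exact continuous_const.mul (((hvol k₁ p₁ hp₁).comp continuous_fst).mul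
        ((hvol k₂ p₂ hp₂).comp continuous_snd))
    · rintro ⟨x, hx⟩
      exact weighted_volume_le_of_mem hΞ hN hA ha hb hab q
        (fun i => hx.1 i (Set.mem_univ i)) (fun i => hx.2 i (Set.mem_univ i)) hp₁ hp₂ ht hg hle
  refine iSup_rpow_mul_le hp₁ fun e he => ?_
  rw [mul_comm]
  refine iSup_rpow_mul_le hp₂ fun f hf => ?_
  have h := hall (e, f)
  simp only [(coreOrthonormal_toCore_iff.2 he).gramDet_eq_one,
    (coreOrthonormal_toCore_iff.2 hf).gramDet_eq_one, Real.sqrt_one, Real.one_rpow, mul_one] at h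
  rw [ENNReal.ofReal_rpow_of_nonneg (Real.sqrt_nonneg _) hp₁.le,
    ENNReal.ofReal_rpow_of_nonneg (Real.sqrt_nonneg _) hp₂.le,
    ← ENNReal.ofReal_mul (by positivity), mul_comm]
  exact ENNReal.ofReal_le_ofReal h

theorem omegaD_one [CompleteSpace H] (T : H →L[𝕜] H) (m : ℕ) :
    omegaD m 1 T = omegaD (m + 1) 0 T := by
  rw [omegaD_eq_maxVolume T m zero_le_one le_rfl, omegaD_eq_maxVolume T (m + 1) le_rfl zero_le_one]
  simp

theorem omegaD_cocycle_le [CompleteSpace H] (hΞ : IsUniformlyContinuousCocycle ϑ Ξ)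
    (hN : AdmitsGrowthExponents ϑ Ξ (fun q => coreNorm (n q)) N)
    (hA : IsMeanRepresentation ϑ Ξ n N A) {a b : ℝ} (ha : 0 < a) (hb : 0 < b)
    (hab : ∀ q ξ, a * ‖ξ‖ ≤ coreNorm (n q) ξ ∧ coreNorm (n q) ξ ≤ b * ‖ξ‖)
    (m : ℕ) {γ : ℝ} (hγ₀ : 0 ≤ γ) (hγ₁ : γ ≤ 1) (q : Q) {t : ℝ≥0} (ht : 0 < t) {g : ℝ → ℝ}
    (hg : IntervalIntegrable g volume 0 t)
    (hle : ∀ᵐ s : ℝ, s ∈ Set.Ioo (0 : ℝ) t →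
      fractionalTraceSum (n (ϑ s.toNNReal q)) (A (ϑ s.toNNReal q)) m γ ≤ g s) :
    omegaD m γ (Ξ t q) ≤
      ENNReal.ofReal ((b / a) ^ (m + γ) * Real.exp (∫ s in (0 : ℝ)..t, g s)) := by
  have hint : ∀ m : ℕ, (∀ᵐ s : ℝ, s ∈ Set.Ioo (0 : ℝ) t →
      fractionalTraceSum (n (ϑ s.toNNReal q)) (A (ϑ s.toNNReal q)) m 0 ≤ g s) →
      omegaD m 0 (Ξ t q) ≤
        ENNReal.ofReal ((b / a) ^ (m : ℝ) * Real.exp (∫ s in (0 : ℝ)..t, g s)) := by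
    intro m hle
    -- For `γ = 0` only order `m` is available. Using it twice with weights `1 / 2` keeps both
    -- weights positive; `γ = 1` is reduced to this case with `m + 1`.
    have key := maxVolume_rpow_mul_le (k₁ := m) (k₂ := m) (p₁ := 1 / 2) (p₂ := 1 / 2)
      hΞ hN hA ha hb hab q (by norm_num) (by norm_num) (NNReal.coe_pos.2 ht) hg
      (hle.mono fun s hs hst v₁ v₂ hv₁ hv₂ hd₁ hd₂ x y hx hy => by
        have h := hs hst
        rw [fractionalTraceSum_zero _ _ hv₁ hd₁] at h
        have h1 := EReal.coe_le_coe_iff.1 (hx.trans h)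
        have h2 := EReal.coe_le_coe_iff.1 (hy.trans h)
        linarith)
    rw [Real.toNNReal_coe, ← ENNReal.rpow_add_of_nonneg _ _ (by norm_num) (by norm_num)] at key
    rw [omegaD_eq_maxVolume _ _ le_rfl zero_le_one]
    rw [sub_zero, ENNReal.rpow_one, ENNReal.rpow_zero, mul_one]
    rw [add_halves, ENNReal.rpow_one, ← mul_add, add_halves, mul_one] at key
    exact key
  rcases hγ₀.eq_or_lt with rfl | hγ₀'
  · rw [add_zero]
    exact hint m hle
  rcases hγ₁.eq_or_lt with rfl | hγ₁'
  · rw [omegaD_one]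
    have := hint (m + 1) (by simpa only [fractionalTraceSum_one] using hle)
    rwa [Nat.cast_succ] at this
  have key := maxVolume_rpow_mul_le (k₁ := m) (k₂ := m + 1) (p₁ := 1 - γ) (p₂ := γ)
    hΞ hN hA ha hb hab q (sub_pos.2 hγ₁') hγ₀' (NNReal.coe_pos.2 ht) hg
    (hle.mono fun s hs hst v₁ v₂ hv₁ hv₂ hd₁ hd₂ x y hx hy =>
      EReal.coe_le_coe_iff.1 ((le_fractionalTraceSum _ _ hγ₀' hγ₁ hv₂ hd₂ hx hy).trans (hs hst)))
  rw [Real.toNNReal_coe, ← omegaD_eq_maxVolume _ _ hγ₀ hγ₁] at key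
  convert key using 4
  push_cast
  ring

end VolumeEstimate

/-! ### Subadditive functions of time with values in the extended reals -/

section Subadditive

theorem subadditive_nsmul_add_le {f : ℝ≥0 → EReal} (hsub : ∀ s t, f (s + t) ≤ f s + f t)
    {a r : ℝ≥0} {x y : ℝ} (ha : f a ≤ x) (hr : f r ≤ y) (k : ℕ) :
    f (k * a + r) ≤ ((k * x + y : ℝ) : EReal) := by
  induction k with
  | zero => simpa using hr
  | succ k ih =>
    have h : ((k + 1 : ℕ) : ℝ≥0) * a + r = a + (k * a + r) := by push_cast; ring
    rw [h]
    refine (hsub _ _).trans ((add_le_add ha ih).trans ?_)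
    rw [← EReal.coe_add, EReal.coe_le_coe_iff]
    push_cast
    linarith

theorem subadditive_le_linear {f : ℝ≥0 → EReal} (hsub : ∀ s t, f (s + t) ≤ f s + f t)
    {a b : ℝ≥0} (ha : 0 < a) {c M : ℝ} (hfa : f a ≤ ((c * a : ℝ) : EReal))
    (hM : ∀ r, b ≤ r → r ≤ b + a → f r ≤ M) {t : ℝ≥0} (ht : b ≤ t) :
    f t ≤ ((c * t + (|c| * (b + a) + M) : ℝ) : EReal) := by
  -- Decompose `t = k a + (b + r')` with `r' ≤ a`: the remainder lies where `M` is a bound, and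
  -- replacing `k a` by `t` costs `-c (b + r') ≤ |c| (b + a)`.
  set k : ℕ := ⌊(t - b) / a⌋₊ with hk
  have hk1 : (k : ℝ≥0) * a ≤ t - b := by
    rw [← le_div_iff₀ ha]
    exact Nat.floor_le zero_le
  have hk2 : t - b < (k + 1 : ℝ≥0) * a := by
    rw [← div_lt_iff₀ ha]
    exact Nat.lt_floor_add_one _
  obtain ⟨r', hr'⟩ := exists_add_of_le hk1
  have hr : t = k * a + (b + r') := by
    rw [← add_tsub_cancel_of_le ht, hr']
    ring
  have hra : r' ≤ a := by
    rw [hr', add_mul, one_mul] at hk2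
    exact (lt_of_add_lt_add_left hk2).le
  have := subadditive_nsmul_add_le hsub hfa (hM (b + r') le_self_add (by gcongr)) k
  rw [← hr] at this
  refine this.trans (EReal.coe_le_coe_iff.2 ?_)
  have htr : (t : ℝ) = k * a + (b + r') := by exact_mod_cast hr
  have h1 : -(c * (b + r')) ≤ |c| * (b + a) := by
    have h2 : (r' : ℝ) ≤ a := by exact_mod_cast hra
    calc -(c * (b + r')) = -c * (b + r') := by ring
      _ ≤ |c| * (b + r') := by
        gcongr
        exact neg_le_abs c
      _ ≤ _ := by gcongr
  rw [htr]
  linarith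

theorem tendsto_coe_const_add_div_atTop (c C : ℝ) :
    Tendsto (fun t : ℝ≥0 => ((c + 1 / (t : ℝ) * C : ℝ) : EReal)) atTop (𝓝 (c : EReal)) := by
  refine (continuous_coe_real_ereal.tendsto c).comp ?_
  have h : Tendsto (fun t : ℝ≥0 => 1 / (t : ℝ)) atTop (𝓝 0) := by
    simpa [Function.comp_def] using tendsto_inv_atTop_zero.comp (NNReal.tendsto_coe_atTop.2 tendsto_id)
  simpa using (h.mul_const C).const_add c

/-- Fekete's lemma in continuous time for functions with values in the extended reals. -/
theorem exists_tendsto_div_of_subadditive {f : ℝ≥0 → EReal}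
    (hsub : ∀ s t, f (s + t) ≤ f s + f t)
    (hbdd : ∀ a : ℝ≥0, ∃ (b : ℝ≥0) (M : ℝ), ∀ r, b ≤ r → r ≤ b + a → f r ≤ M) :
    ∃ l : EReal, Tendsto (fun t : ℝ≥0 => ((1 / (t : ℝ) : ℝ) : EReal) * f t) atTop (𝓝 l) := by
  refine ⟨_, tendsto_of_le_liminf_of_limsup_le le_rfl ?_⟩
  -- The limit is the lower limit. For each real `c` above it, some `a > 0` satisfies `f a ≤ c a`,
  -- and the linear bound gives an upper limit of at most `c`.
  refine EReal.le_of_forall_lt_iff_le.1 fun c hc => ?_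
  obtain ⟨a, hac, ha⟩ := ((frequently_lt_of_liminf_lt (by isBoundedDefault) hc).and_eventually
    (eventually_gt_atTop 0)).exists
  obtain ⟨b, M, hM⟩ := hbdd a
  have ha' : (0 : ℝ) < a := NNReal.coe_pos.2 ha
  have hfa : f a ≤ ((c * a : ℝ) : EReal) := by
    have h := mul_le_mul_of_nonneg_left hac.le (EReal.coe_nonneg.2 ha'.le)
    rw [← mul_assoc, ← EReal.coe_mul, mul_one_div_cancel ha'.ne', EReal.coe_one, one_mul,
      ← EReal.coe_mul, mul_comm (a : ℝ)] at h
    exact h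
  have hlim := tendsto_coe_const_add_div_atTop c (|c| * (b + a) + M)
  rw [← hlim.limsup_eq]
  refine limsup_le_limsup ?_
  filter_upwards [eventually_ge_atTop b, eventually_gt_atTop 0] with t htb ht0
  have ht' : (0 : ℝ) < t := NNReal.coe_pos.2 ht0
  refine (mul_le_mul_of_nonneg_left (subadditive_le_linear hsub ha hfa hM htb)
    (EReal.coe_nonneg.2 (by positivity))).trans ?_
  rw [← EReal.coe_mul, EReal.coe_le_coe_iff, mul_add, mul_left_comm, one_div_mul_cancel ht'.ne',
    mul_one]

theorem le_liminf_of_le_const_add {f g : ℝ≥0 → EReal} {l : EReal} (c : ℝ)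
    (hl : Tendsto (fun t : ℝ≥0 => ((1 / (t : ℝ) : ℝ) : EReal) * f t) atTop (𝓝 l))
    (h : ∀ t, 0 < t → f t ≤ c + g t) :
    l ≤ liminf (fun t : ℝ≥0 => ((1 / (t : ℝ) : ℝ) : EReal) * g t) atTop := by
  have hc : Tendsto (fun t : ℝ≥0 => ((1 / (t : ℝ) : ℝ) : EReal) * (c : EReal)) atTop (𝓝 0) := by
    simpa using tendsto_coe_const_add_div_atTop 0 c
  rw [← hl.liminf_eq]
  calc _ ≤ liminf ((fun t : ℝ≥0 => ((1 / (t : ℝ) : ℝ) : EReal) * (c : EReal)) +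
        fun t : ℝ≥0 => ((1 / (t : ℝ) : ℝ) : EReal) * g t) atTop := by
        refine liminf_le_liminf ?_
        filter_upwards [eventually_gt_atTop 0] with t ht
        have ht' : (0 : EReal) ≤ ((1 / (t : ℝ) : ℝ) : EReal) := EReal.coe_nonneg.2 (by positivity)
        rw [Pi.add_apply, ← EReal.left_distrib_of_nonneg_of_ne_top ht' (EReal.coe_ne_top _)]
        exact mul_le_mul_of_nonneg_left (h t ht) ht'
    _ ≤ limsup (fun t : ℝ≥0 => ((1 / (t : ℝ) : ℝ) : EReal) * (c : EReal)) atTop +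
        liminf (fun t : ℝ≥0 => ((1 / (t : ℝ) : ℝ) : EReal) * g t) atTop :=
        EReal.liminf_add_le (Or.inl (by rw [hc.limsup_eq]; exact EReal.zero_ne_bot))
          (Or.inl (by rw [hc.limsup_eq]; exact EReal.zero_ne_top))
    _ = _ := by rw [hc.limsup_eq, zero_add]

/-- A subadditive supremum of continuous functions that is eventually finite is bounded above on
intervals of any length. -/
theorem exists_bound_of_iSup_continuous {ι : Type*} {I : ι → ℝ≥0 → ℝ}
    (hI : ∀ i, Continuous (I i))
    (hsub : ∀ s t, (⨆ i, ((I i (s + t) : ℝ) : EReal)) ≤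
      (⨆ i, ((I i s : ℝ) : EReal)) + ⨆ i, ((I i t : ℝ) : EReal))
    (hfin : ∀ᶠ t : ℝ≥0 in atTop, (⨆ i, ((I i t : ℝ) : EReal)) ≠ ⊤) (a : ℝ≥0) :
    ∃ (b : ℝ≥0) (M : ℝ), ∀ r, b ≤ r → r ≤ b + a → (⨆ i, ((I i r : ℝ) : EReal)) ≤ M := by
  obtain ⟨T, hT⟩ := eventually_atTop.1 hfin
  let C : ℕ → Set ℝ≥0 := fun j => {t | ∀ i, I i (T + t) ≤ j}
  have hclosed : ∀ j, IsClosed (C j) := fun j => by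
    simp only [C, Set.ofPred_forall]
    exact isClosed_iInter fun i =>
      isClosed_le ((hI i).comp (continuous_const.add continuous_id)) continuous_const
  have hcover : ⋃ j, C j = Set.univ := Set.eq_univ_of_forall fun t => by
    obtain ⟨j, hj⟩ := exists_nat_ge (⨆ i, ((I i (T + t) : ℝ) : EReal)).toReal
    refine Set.mem_iUnion.2 ⟨j, fun i => ?_⟩
    have h1 := (le_iSup (fun i => ((I i (T + t) : ℝ) : EReal)) i).trans
      (EReal.le_coe_toReal (hT (T + t) le_self_add))
    exact (EReal.coe_le_coe_iff.1 h1).trans hj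
  -- By Baire's theorem all `I i` are bounded by one `j` on a short interval starting at `T + x`.
  obtain ⟨j, x, hx⟩ := nonempty_interior_of_iUnion_of_closed hclosed hcover
  obtain ⟨ε, hε, hball⟩ := Metric.isOpen_iff.1 isOpen_interior x hx
  let δ : ℝ≥0 := (ε / 2).toNNReal
  have hδ : 0 < δ := Real.toNNReal_pos.2 (half_pos hε)
  have hδ' : (δ : ℝ) = ε / 2 := Real.coe_toNNReal _ (half_pos hε).le
  have hloc : ∀ ρ ≤ δ, (⨆ i, ((I i (T + (x + ρ)) : ℝ) : EReal)) ≤ ((j : ℝ) : EReal) := by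
    intro ρ hρ
    have hmem : x + ρ ∈ C j := interior_subset <| hball <| by
      rw [Metric.mem_ball, NNReal.dist_eq, NNReal.coe_add, add_sub_cancel_left,
        abs_of_nonneg ρ.coe_nonneg]
      have : (ρ : ℝ) ≤ δ := NNReal.coe_le_coe.2 hρ
      linarith
    exact iSup_le fun i => EReal.coe_le_coe_iff.2 (hmem i)
  set P : ℕ := ⌊a / δ⌋₊ with hP
  let F : ℕ → ℝ := fun l => |(⨆ i, ((I i (T + l * δ) : ℝ) : EReal)).toReal|
  -- A time in the long interval is a time in the short one plus a grid time `T + l δ` with `l ≤ P`.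
  -- The second `T` puts the grid where the supremum is not `∞`; finitely many grid values occur.
  refine ⟨T + x + T, j + ∑ l ∈ Finset.range (P + 1), F l, fun r hr1 hr2 => ?_⟩
  obtain ⟨y, rfl⟩ := exists_add_of_le hr1
  have hya : y ≤ a := le_of_add_le_add_left hr2
  set l : ℕ := ⌊y / δ⌋₊ with hl
  have hl1 : (l : ℝ≥0) * δ ≤ y := by
    rw [← le_div_iff₀ hδ]
    exact Nat.floor_le zero_le
  have hl2 : y < (l + 1 : ℝ≥0) * δ := by
    rw [← div_lt_iff₀ hδ]
    exact Nat.lt_floor_add_one _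
  have hlP : l ∈ Finset.range (P + 1) :=
    Finset.mem_range.2 (Nat.lt_succ_iff.2 (Nat.floor_mono (by gcongr)))
  obtain ⟨ρ, hρ⟩ := exists_add_of_le hl1
  have hρδ : ρ ≤ δ := by
    rw [hρ, add_mul, one_mul] at hl2
    exact (lt_of_add_lt_add_left hl2).le
  have hdec : T + x + T + y = (T + (x + ρ)) + (T + l * δ) := by
    rw [hρ]
    ring
  rw [hdec]
  have hF : (⨆ i, ((I i (T + l * δ) : ℝ) : EReal)) ≤ (F l : EReal) :=
    (EReal.le_coe_toReal (hT _ le_self_add)).trans (EReal.coe_le_coe_iff.2 (le_abs_self _))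
  refine (hsub _ _).trans ((add_le_add (hloc ρ hρδ) hF).trans ?_)
  rw [← EReal.coe_add, EReal.coe_le_coe_iff]
  gcongr
  exact Finset.single_le_sum (f := F) (fun _ _ => abs_nonneg _) hlP

end Subadditive

/-! ### Time averages of the fractional trace sums -/

section TimeAverages

theorem EReal.coe_finset_sum_real {ι : Type*} (s : Finset ι) (f : ι → ℝ) :
    ((∑ i ∈ s, f i : ℝ) : EReal) = ∑ i ∈ s, (f i : EReal) := by
  classical
  induction s using Finset.induction_on with
  | empty => simp
  | insert i s hi ih => rw [Finset.sum_insert hi, Finset.sum_insert hi, EReal.coe_add, ih]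

theorem fractionalTraceSum_eq_coe {𝕜 V : Type*} [RCLike 𝕜] [AddCommGroup V] [Module 𝕜 V]
    (c : InnerProductSpace.Core 𝕜 V) (A : V →ₗ.[𝕜] V) (m : ℕ) (γ : ℝ)
    (h : ∀ j ∈ Finset.Icc 1 (m + 1), traceNumber c A j ≠ ⊤ ∧ traceNumber c A j ≠ ⊥) :
    fractionalTraceSum c A m γ = ((∑ j ∈ Finset.Icc 1 m, (traceNumber c A j).toReal +
      γ * (traceNumber c A (m + 1)).toReal : ℝ) : EReal) := by
  have hcoe : ∀ j ∈ Finset.Icc 1 (m + 1), ((traceNumber c A j).toReal : EReal) = traceNumber c A j :=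
    fun j hj => EReal.coe_toReal (h j hj).1 (h j hj).2
  rw [fractionalTraceSum, EReal.coe_add, EReal.coe_mul, EReal.coe_finset_sum_real,
    hcoe (m + 1) (Finset.right_mem_Icc.2 (Nat.le_add_left 1 m))]
  congr 1
  refine Finset.sum_congr rfl fun j hj => (hcoe j ?_).symm
  exact Finset.Icc_subset_Icc_right (Nat.le_succ m) hj

theorem locallyIntegrableInTime_fractionalTraceSum {𝕜 V : Type*} [RCLike 𝕜] [AddCommGroup V]
    [Module 𝕜 V] {c : ℝ≥0 → InnerProductSpace.Core 𝕜 V} {A : ℝ≥0 → V →ₗ.[𝕜] V} {m : ℕ} (γ : ℝ)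
    (h : ∀ j ∈ Finset.Icc 1 (m + 1), LocallyIntegrableInTime fun s => traceNumber (c s) (A s) j) :
    LocallyIntegrableInTime fun s => fractionalTraceSum (c s) (A s) m γ := by
  have hae : ∀ᵐ s : ℝ, 0 < s → fractionalTraceSum (c s.toNNReal) (A s.toNNReal) m γ =
      ((∑ j ∈ Finset.Icc 1 m, (traceNumber (c s.toNNReal) (A s.toNNReal) j).toReal +
        γ * (traceNumber (c s.toNNReal) (A s.toNNReal) (m + 1)).toReal : ℝ) : EReal) := by
    have hall := (Filter.eventually_all_finset (Finset.Icc 1 (m + 1))).2 fun j hj => (h j hj).1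
    filter_upwards [hall] with s hs hs0
    exact fractionalTraceSum_eq_coe _ _ m γ fun j hj => hs j hj hs0
  refine ⟨?_, fun T hT => ?_⟩
  · filter_upwards [hae] with s hs hs0
    rw [hs hs0]
    exact ⟨EReal.coe_ne_top _, EReal.coe_ne_bot _⟩
  · have hsum : IntervalIntegrable (fun s : ℝ =>
        ∑ j ∈ Finset.Icc 1 m, (traceNumber (c s.toNNReal) (A s.toNNReal) j).toReal +
        γ * (traceNumber (c s.toNNReal) (A s.toNNReal) (m + 1)).toReal) volume 0 T := by
      refine IntervalIntegrable.add ?_ (((h (m + 1)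
        (Finset.right_mem_Icc.2 (Nat.le_add_left 1 m))).2 T hT).const_mul γ)
      have := IntervalIntegrable.sum (Finset.Icc 1 m) fun j hj =>
        (h j (Finset.Icc_subset_Icc_right (Nat.le_succ m) hj)).2 T hT
      simpa [Finset.sum_fn] using this
    refine hsum.congr_ae ?_
    rw [Set.uIoc_of_le hT.le]
    refine (ae_restrict_iff' measurableSet_Ioc).2 ?_
    filter_upwards [hae] with s hs hst
    rw [hs hst.1, EReal.toReal_coe]

theorem LocallyIntegrableInTime.intervalIntegrable {f : ℝ≥0 → EReal}
    (hf : LocallyIntegrableInTime f) (a b : ℝ) :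
    IntervalIntegrable (fun s : ℝ => (f s.toNNReal).toReal) volume a b := by
  have h0 : ∀ T : ℝ, IntervalIntegrable (fun s : ℝ => (f s.toNNReal).toReal) volume 0 T := by
    intro T
    rcases lt_or_ge 0 T with hT | hT
    · exact hf.2 T hT
    -- `Real.toNNReal` sends nonpositive times to `0`, so the integrand is constant there.
    · refine (intervalIntegrable_const (c := (f 0).toReal)).congr fun s hs => ?_
      rw [Set.uIoc_of_ge hT] at hs
      simp only [Real.toNNReal_of_nonpos hs.2]
  exact (h0 a).symm.trans (h0 b)

/-- The integral of an extended-real function over `[0, t]`. -/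
def timeIntegral (f : ℝ≥0 → EReal) (t : ℝ≥0) : ℝ :=
  ∫ s in (0 : ℝ)..t, (f s.toNNReal).toReal

theorem LocallyIntegrableInTime.continuous_timeIntegral {f : ℝ≥0 → EReal}
    (hf : LocallyIntegrableInTime f) : Continuous (timeIntegral f) :=
  (intervalIntegral.continuous_primitive hf.intervalIntegrable 0).comp NNReal.continuous_coe

theorem LocallyIntegrableInTime.timeIntegral_add {f : ℝ≥0 → EReal}
    (hf : LocallyIntegrableInTime f) (s t : ℝ≥0) :
    timeIntegral f (s + t) = timeIntegral f s + timeIntegral (fun u => f (s + u)) t := by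
  have h1 : timeIntegral (fun u => f (s + u)) t =
      ∫ u in (0 : ℝ)..t, (f (s + u : ℝ).toNNReal).toReal := by
    refine intervalIntegral.integral_congr fun u hu => ?_
    rw [Set.uIcc_of_le t.coe_nonneg] at hu
    simp only [Real.toNNReal_add s.coe_nonneg hu.1, Real.toNNReal_coe]
  rw [h1, intervalIntegral.integral_comp_add_left (fun u : ℝ => (f u.toNNReal).toReal), add_zero,
    timeIntegral, timeIntegral, NNReal.coe_add,
    intervalIntegral.integral_add_adjacent_intervals (hf.intervalIntegrable _ _)
      (hf.intervalIntegrable _ _)]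

variable {𝕜 H Q : Type*} [RCLike 𝕜] [AddCommGroup H] [Module 𝕜 H] [TopologicalSpace Q]
  {ϑ : Flow ℝ≥0 Q} {n : Q → InnerProductSpace.Core 𝕜 H} {A : Q → H →ₗ.[𝕜] H} {m : ℕ} {γ : ℝ}

/-- The integral over `[s, s + t]` along the orbit of `q` is the integral over `[0, t]` along the
orbit of `ϑ s q`. -/
theorem maximalTraceIntegral_add_le (hint : ∀ q, LocallyIntegrableInTime fun s =>
      fractionalTraceSum (n (ϑ s q)) (A (ϑ s q)) m γ) (s t : ℝ≥0) :
    maximalTraceIntegral ϑ n A m γ (s + t) ≤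
      maximalTraceIntegral ϑ n A m γ s + maximalTraceIntegral ϑ n A m γ t := by
  refine iSup_le fun q => ?_
  have h := (hint q).timeIntegral_add s t
  have hflow : (fun u => fractionalTraceSum (n (ϑ (s + u) q)) (A (ϑ (s + u) q)) m γ)
      = fun u => fractionalTraceSum (n (ϑ u (ϑ s q))) (A (ϑ u (ϑ s q))) m γ := by
    funext u
    rw [add_comm s u, Flow.map_add]
  rw [hflow] at h
  refine (EReal.coe_le_coe_iff.2 h.le).trans ?_
  rw [EReal.coe_add]
  exact add_le_add (le_iSup_of_le q le_rfl) (le_iSup_of_le (ϑ s q) le_rfl)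

theorem exists_bound_maximalTraceIntegral (hint : ∀ q, LocallyIntegrableInTime fun s =>
      fractionalTraceSum (n (ϑ s q)) (A (ϑ s q)) m γ)
    (hfin : ∀ᶠ t : ℝ≥0 in atTop, maximalTraceIntegral ϑ n A m γ t ≠ ⊤) (a : ℝ≥0) :
    ∃ (b : ℝ≥0) (M : ℝ), ∀ r, b ≤ r → r ≤ b + a → maximalTraceIntegral ϑ n A m γ r ≤ M :=
  exists_bound_of_iSup_continuous
    (I := fun q => timeIntegral fun s => fractionalTraceSum (n (ϑ s q)) (A (ϑ s q)) m γ)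
    (fun q => (hint q).continuous_timeIntegral) (maximalTraceIntegral_add_le hint) hfin a

end TimeAverages

/-! ### The averaged function of singular values -/

section AveragedOmega

variable {𝕜 H Q : Type*} [RCLike 𝕜] [NormedAddCommGroup H] [InnerProductSpace 𝕜 H]
  [TopologicalSpace Q] {ϑ : Flow ℝ≥0 Q} {Ξ : ℝ≥0 → Q → H →L[𝕜] H} {m : ℕ} {γ : ℝ}

theorem log_iSup_omegaD_add_le [CompleteSpace H] (hΞ : IsUniformlyContinuousCocycle ϑ Ξ)
    (hγ₀ : 0 ≤ γ) (hγ₁ : γ ≤ 1) (s t : ℝ≥0) :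
    ENNReal.log (⨆ q, omegaD m γ (Ξ (s + t) q)) ≤
      ENNReal.log (⨆ q, omegaD m γ (Ξ s q)) + ENNReal.log (⨆ q, omegaD m γ (Ξ t q)) := by
  rw [← ENNReal.log_mul_add]
  refine ENNReal.log_le_log (iSup_le fun q => ?_)
  rw [hΞ.map_add]
  exact (omegaD_comp_le _ _ m hγ₀ hγ₁).trans (mul_le_mul'
    (le_iSup (fun q => omegaD m γ (Ξ s q)) (ϑ t q)) (le_iSup (fun q => omegaD m γ (Ξ t q)) q))

/-- The uniform norm bound covers times up to `1`; subadditivity extends it one unit at a time. This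
supplies the boundedness that Fekete's lemma requires. -/
theorem exists_bound_log_iSup_omegaD [CompleteSpace H] (hΞ : IsUniformlyContinuousCocycle ϑ Ξ)
    (hγ₀ : 0 ≤ γ) (hγ₁ : γ ≤ 1) (a : ℝ≥0) :
    ∃ M : ℝ, ∀ t ≤ a, ENNReal.log (⨆ q, omegaD m γ (Ξ t q)) ≤ M := by
  obtain ⟨C, hC⟩ := hΞ.bounded
  set B : ℝ≥0∞ := ENNReal.ofReal C ^ m * ENNReal.ofReal C ^ γ with hB
  have hBtop : ENNReal.log B ≠ ⊤ := by
    rw [Ne, ENNReal.log_eq_top_iff]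
    exact ENNReal.mul_ne_top (ENNReal.pow_ne_top ENNReal.ofReal_ne_top)
      (ENNReal.rpow_ne_top_of_nonneg hγ₀ ENNReal.ofReal_ne_top)
  set M : ℝ := |(ENNReal.log B).toReal| with hM
  have hunit : ∀ t : ℝ≥0, t ≤ 1 → ENNReal.log (⨆ q, omegaD m γ (Ξ t q)) ≤ M := fun t ht => by
    refine le_trans (ENNReal.log_le_log (iSup_le fun q => ?_))
      ((EReal.le_coe_toReal hBtop).trans (EReal.coe_le_coe_iff.2 (le_abs_self _)))
    refine (omegaD_le_enorm (Ξ t q) m hγ₀).trans ?_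
    have : ‖Ξ t q‖ₑ ≤ ENNReal.ofReal C := by
      rw [← ofReal_norm]
      exact ENNReal.ofReal_le_ofReal (hC t ht q)
    rw [hB]
    gcongr
  have hnat : ∀ (k : ℕ) (t : ℝ≥0), t ≤ k + 1 →
      ENNReal.log (⨆ q, omegaD m γ (Ξ t q)) ≤ (((k + 1 : ℕ) * M : ℝ) : EReal) := by
    intro k
    induction k with
    | zero => exact fun t ht => by simpa using hunit t (by simpa using ht)
    | succ k ih =>
      intro t ht
      have hsplit : t = min t 1 + (t - 1) := by
        rcases le_total t 1 with h | h
        · rw [min_eq_left h, tsub_eq_zero_of_le h, add_zero]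
        · rw [min_eq_right h, add_tsub_cancel_of_le h]
      rw [hsplit]
      refine (log_iSup_omegaD_add_le hΞ hγ₀ hγ₁ _ _).trans ((add_le_add
        (hunit _ (min_le_right t 1)) (ih (t - 1) (tsub_le_iff_right.2 ?_))).trans ?_)
      · simpa using ht
      · rw [← EReal.coe_add, EReal.coe_le_coe_iff]
        push_cast
        linarith
  obtain ⟨k, hk⟩ := exists_nat_ge a
  exact ⟨_, fun t ht => hnat k t (ht.trans (hk.trans (le_add_of_nonneg_right zero_le_one)))⟩

/-- Fekete's limit of the logarithms is carried over by the homeomorphism `exp` from `[-∞, ∞]` to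
`[0, ∞]`, so a volume rate of `0` needs no exception. -/
theorem tendsto_log_averagedOmega [CompleteSpace H] (hΞ : IsUniformlyContinuousCocycle ϑ Ξ)
    (hγ₀ : 0 ≤ γ) (hγ₁ : γ ≤ 1) :
    Tendsto (omegaRoot Ξ m γ) atTop (𝓝 (averagedOmega Ξ m γ)) ∧
    Tendsto (fun t : ℝ≥0 => ((1 / (t : ℝ) : ℝ) : EReal) *
        ENNReal.log (⨆ q, omegaD m γ (Ξ t q))) atTop
      (𝓝 (ENNReal.log (averagedOmega Ξ m γ))) := by
  obtain ⟨l, hl⟩ := exists_tendsto_div_of_subadditive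
    (log_iSup_omegaD_add_le (m := m) hΞ hγ₀ hγ₁) fun a => by
      obtain ⟨M, hM⟩ := exists_bound_log_iSup_omegaD (m := m) hΞ hγ₀ hγ₁ a
      exact ⟨0, M, fun r _ hr => hM r (by simpa using hr)⟩
  have hroot : Tendsto (omegaRoot Ξ m γ) atTop (𝓝 (EReal.exp l)) := by
    refine ((EReal.expHomeomorph.continuous.tendsto l).comp hl).congr fun t => ?_
    rw [Function.comp_apply, ← ENNReal.log_rpow]
    exact ENNReal.exp_log _
  have havg : averagedOmega Ξ m γ = EReal.exp l := hroot.limUnder_eq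
  rw [havg, EReal.log_exp]
  exact ⟨hroot, hl⟩

/-- The majorant `g` is left free to serve both estimates: a constant above the supremum over the
base, and the trace numbers along the orbit. The additive constant is independent of `t`. -/
theorem log_iSup_omegaD_le {n : Q → InnerProductSpace.Core 𝕜 H} {N : Q → Submodule 𝕜 H}
    {A : Q → H →ₗ.[𝕜] H} [CompleteSpace H] (hΞ : IsUniformlyContinuousCocycle ϑ Ξ)
    (hN : AdmitsGrowthExponents ϑ Ξ (fun q => coreNorm (n q)) N)
    (hA : IsMeanRepresentation ϑ Ξ n N A) {a b : ℝ} (ha : 0 < a) (hb : 0 < b)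
    (hab : ∀ q ξ, a * ‖ξ‖ ≤ coreNorm (n q) ξ ∧ coreNorm (n q) ξ ≤ b * ‖ξ‖)
    (hγ₀ : 0 ≤ γ) (hγ₁ : γ ≤ 1) {t : ℝ≥0} (ht : 0 < t) {g : Q → ℝ → ℝ}
    (hg : ∀ q, IntervalIntegrable (g q) volume 0 t)
    (hle : ∀ q, ∀ᵐ s : ℝ, s ∈ Set.Ioo (0 : ℝ) t →
      fractionalTraceSum (n (ϑ s.toNNReal q)) (A (ϑ s.toNNReal q)) m γ ≤ g q s) :
    ENNReal.log (⨆ q, omegaD m γ (Ξ t q)) ≤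
      ((Real.log ((b / a) ^ (m + γ)) : ℝ) : EReal) +
        ⨆ q, ((∫ s in (0 : ℝ)..t, g q s : ℝ) : EReal) := by
  have hmap : ENNReal.log (⨆ q, omegaD m γ (Ξ t q)) = ⨆ q, ENNReal.log (omegaD m γ (Ξ t q)) :=
    ENNReal.logOrderIso.map_iSup _
  have hK : 0 < (b / a) ^ (m + γ) := Real.rpow_pos_of_pos (div_pos hb ha) _
  rw [hmap]
  refine iSup_le fun q => ?_
  refine (ENNReal.log_le_log (omegaD_cocycle_le hΞ hN hA ha hb hab m hγ₀ hγ₁ q ht (hg q)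
    (hle q))).trans ?_
  rw [ENNReal.log_ofReal_of_pos (mul_pos hK (Real.exp_pos _)),
    Real.log_mul hK.ne' (Real.exp_pos _).ne', Real.log_exp, EReal.coe_add]
  gcongr
  exact le_iSup (fun q => ((∫ s in (0 : ℝ)..t, g q s : ℝ) : EReal)) q

end AveragedOmega

end

theorem mainTheorem4 {𝕜 H Q : Type*} [RCLike 𝕜] [NormedAddCommGroup H] [InnerProductSpace 𝕜 H]
    [CompleteSpace H] [TopologicalSpace.SeparableSpace H] [MetricSpace Q] [CompleteSpace Q]
    (ϑ : Flow ℝ≥0 Q) (Ξ : ℝ≥0 → Q → H →L[𝕜] H) (hΞ : IsUniformlyContinuousCocycle ϑ Ξ)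
    (n : Q → InnerProductSpace.Core 𝕜 H) (hn : UniformlyEquivalent n)
    (N : Q → Submodule 𝕜 H)
    (hN : AdmitsGrowthExponents ϑ Ξ (fun q => coreNorm (n q)) N)
    (A : Q → H →ₗ.[𝕜] H) (hA : IsMeanRepresentation ϑ Ξ n N A)
    (m : ℕ) (γ : ℝ) (hγ₀ : 0 ≤ γ) (hγ₁ : γ ≤ 1) :
    -- the limit that defines the averaged function of singular values exists
    Tendsto (omegaRoot Ξ m γ) atTop (𝓝 (averagedOmega Ξ m γ)) ∧
    -- the estimate by the supremum over the base
    ENNReal.log (averagedOmega Ξ m γ) ≤ ⨆ q, fractionalTraceSum (n q) (A q) m γ ∧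
    -- the time-averaged estimate
    ((∀ q, ∀ j ∈ Finset.Icc 1 (m + 1),
        LocallyIntegrableInTime fun s => traceNumber (n (ϑ s q)) (A (ϑ s q)) j) →
      ENNReal.log (averagedOmega Ξ m γ) ≤
          liminf (fun t : ℝ≥0 =>
            ((1 / (t : ℝ) : ℝ) : EReal) * maximalTraceIntegral ϑ n A m γ t) atTop ∧
      ((∀ᶠ t : ℝ≥0 in atTop, maximalTraceIntegral ϑ n A m γ t ≠ ⊤) →
        ∃ l : EReal,
          Tendsto (fun t : ℝ≥0 =>
            ((1 / (t : ℝ) : ℝ) : EReal) * maximalTraceIntegral ϑ n A m γ t) atTop (𝓝 l) ∧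
          ENNReal.log (averagedOmega Ξ m γ) ≤ l)) := by
  obtain ⟨a, b, ha, hb, hab⟩ := hn
  obtain ⟨hroot, hlog⟩ := tendsto_log_averagedOmega (m := m) hΞ hγ₀ hγ₁
  refine ⟨hroot, ?_, fun hint => ?_⟩
  · refine EReal.le_of_forall_lt_iff_le.1 fun S hS => ?_
    have h := le_liminf_of_le_const_add (g := fun t : ℝ≥0 => ((t * S : ℝ) : EReal)) _ hlog
      fun t ht => (log_iSup_omegaD_le (m := m) hΞ hN hA ha hb hab hγ₀ hγ₁ ht
        (g := fun _ _ => S) (fun _ => intervalIntegrable_const) fun q => ae_of_all _ fun s _ =>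
          (le_iSup (fun q => fractionalTraceSum (n q) (A q) m γ) _).trans hS.le).trans <| by
        gcongr
        -- Only an inequality is claimed, since the base may be empty.
        refine iSup_le fun q => ?_
        rw [intervalIntegral.integral_const, sub_zero, smul_eq_mul]
    have hconst : Tendsto (fun t : ℝ≥0 => ((1 / (t : ℝ) : ℝ) : EReal) * ((t * S : ℝ) : EReal))
        atTop (𝓝 (S : EReal)) := by
      refine tendsto_const_nhds.congr' ?_
      filter_upwards [eventually_gt_atTop 0] with t ht
      rw [← EReal.coe_mul, ← mul_assoc, one_div_mul_cancel (NNReal.coe_pos.2 ht).ne', one_mul]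
    rwa [hconst.liminf_eq] at h
  · have hfrac : ∀ q, LocallyIntegrableInTime fun s =>
        fractionalTraceSum (n (ϑ s q)) (A (ϑ s q)) m γ := fun q =>
      locallyIntegrableInTime_fractionalTraceSum (c := fun s => n (ϑ s q))
        (A := fun s => A (ϑ s q)) γ (hint q)
    have hle := le_liminf_of_le_const_add (g := maximalTraceIntegral ϑ n A m γ) _ hlog
      fun t ht => log_iSup_omegaD_le (m := m) hΞ hN hA ha hb hab hγ₀ hγ₁ ht
        (fun q => (hfrac q).intervalIntegrable 0 t) fun q => by
          filter_upwards [(hfrac q).1] with s hs hst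
          -- `toReal` sends `∞` to `0`, so this bound relies on finiteness almost everywhere.
          exact EReal.le_coe_toReal (hs hst.1).1
    refine ⟨hle, fun hfin => ?_⟩
    obtain ⟨l, hl⟩ := exists_tendsto_div_of_subadditive (maximalTraceIntegral_add_le hfrac)
      (exists_bound_maximalTraceIntegral hfrac hfin)
    exact ⟨l, hl, hl.liminf_eq ▸ hle⟩
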